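/- All manifolds are finite-dimensional, smooth, Hausdorff, paracompact and connected, without boundary. Let $(F,\mathcal V_F)$ be a Poisson manifold and let $\pi:E\to B$ be a Poisson fiber bundle with fiber $F$: there are an open cover $(U_i)$ of $B$ and diffeomorphisms $\phi_i:\pi^{-1}(U_i)\to U_i\times F$ over $U_i$ such that for all $b\in U_i\cap U_j$ the transition map $\phi_i(b)\circ\phi_j(b)^{-1}$ is a Poisson isomorphism of $(F,\mathcal V_F)$. Let $\mathrm{Vert}=\ker T\pi\subset TE$, let $\mathrm{Ann}(\mathrm{Vert})\subset T^*E$ be its annihilator, and let $\mathcal V$ be the vertical bivector field on $E$ that restricts on each fiber $E_b$ to $\mathcal V_b=(\phi_i(b)^{-1})_*\mathcal V_F$. A Dirac structure on $E$ is a smooth sub-bundle $L\subset TE\oplus T^*E$ that is maximally isotropic for $\langle (X_1,\xi_1),(X_2,\xi_2)\rangle_+=\tfrac12(\xi_1(X_2)+\xi_2(X_1))$ and whose space of smooth sections is closed under $[(X_1,\xi_1),(X_2,\xi_2)]=([X_1,X_2],\ \mathcal L_{X_1}\xi_2-i_{X_2}d\xi_1)$. It restricts to the fiber Poisson structures if for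 every $b\in B$ and $x\in E_b$ the set $\{(u,v|_{T_xE_b}) : (u,v)\in L_x,\ u\in T_xE_b\}$ is the graph $\{(\mathcal V_b^\sharp a,a) : a\in T_x^*E_b\}$. The bundle is called coherent if there is a Dirac structure $L$ on $E$ that restricts to the fiber Poisson structures and satisfies $L\cap(\mathrm{Vert}\oplus\mathrm{Ann}(\mathrm{Vert}))=0$. A Poisson–Ehresmann connection is a smooth sub-bundle $\mathrm{Hor}\subset TE$ with $TE=\mathrm{Hor}\oplus\mathrm{Vert}$ such that $\mathcal L_{\mathrm{hor}(X)}\mathcal V=0$ for every smooth vector field $X$ on $B$, where $\mathrm{hor}(X)$ is the horizontal lift of $X$, i.e. the (smooth) section of $\mathrm{Hor}$ that projects to $X$. **Proposition.** Every coherent Poisson fiber bundle $\pi:E\to B$ admits a Poisson–Ehresmann connection. More precisely, for every Dirac structure $L$ on $E$ that restricts to the fiber Poisson structures and satisfies $L\cap(\mathrm{Vert}\oplus\mathrm{Ann}(\mathrm{Vert}))=0$, the subspaces $$H_x(L)=\{Y\in T_xE : (Y,\beta)\in L_x \text{ for some } \beta\in\mathrm{Ann}(\mathrm{Vert}_x)\},\qquad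 x\in E,$$ form the horizontal distribution of a Poisson–Ehresmann connection. -/

import Mathlib

open scoped Manifold ContDiff Topology

noncomputable section

namespace PoissonGeom

/-! ## Tensor calculus on a manifold

Manifolds are modelled on a real normed space `EM` without boundary. -/

section Calculus

variable {EM : Type*} [NormedAddCommGroup EM] [NormedSpace ℝ EM]
variable {M : Type*} [TopologicalSpace M] [ChartedSpace EM M]

variable (EM) in
/-- The tangent space `T_x M`. -/
abbrev Tan (x : M) : Type _ := TangentSpace 𝓘(ℝ, EM) x

variable (EM) in
/-- The cotangent space `T*_x M`. -/
abbrev Cot (x : M) : Type _ := TangentSpace 𝓘(ℝ, EM) x →L[ℝ] ℝ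

/-- The vector field `X` is smooth on the set `U`. -/
def SmoothVFOn [IsManifold 𝓘(ℝ, EM) ∞ M] (X : Π x : M, Tan EM x) (U : Set M) : Prop :=
  ContMDiffOn 𝓘(ℝ, EM) (𝓘(ℝ, EM).prod 𝓘(ℝ, EM)) ∞
    (fun x => Bundle.TotalSpace.mk' EM (E := fun x : M => TangentSpace 𝓘(ℝ, EM) x) x (X x)) U

/-- The 1-form `ξ` is smooth on the set `U`, as a section of the cotangent bundle. -/
def SmoothFormOn [IsManifold 𝓘(ℝ, EM) ∞ M] (ξ : Π x : M, Cot EM x) (U : Set M) : Prop :=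
  ContMDiffOn 𝓘(ℝ, EM) (𝓘(ℝ, EM).prod 𝓘(ℝ, EM →L[ℝ] ℝ)) ∞
    (fun x => Bundle.TotalSpace.mk' (EM →L[ℝ] ℝ)
      (E := fun x : M => TangentSpace 𝓘(ℝ, EM) x →L[ℝ] ℝ) x (ξ x)) U

/-- The differential of a real function, as a 1-form. -/
def dFun (f : M → ℝ) (x : M) : Cot EM x := mfderiv 𝓘(ℝ, EM) 𝓘(ℝ, ℝ) f x

/-- The local representative of a 1-form in the chart at `x₀`, i.e. its pull-back by the inverse
of that chart: a map from the model space to its dual. -/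
def chartForm (ξ : Π x : M, Cot EM x) (x₀ : M) (y : EM) : EM →L[ℝ] ℝ :=
  (ξ ((extChartAt 𝓘(ℝ, EM) x₀).symm y)).comp
    (mfderiv 𝓘(ℝ, EM) 𝓘(ℝ, EM) (extChartAt 𝓘(ℝ, EM) x₀).symm y)

/-- The exterior derivative of a 1-form `ξ` at `x`, as the map `u ↦ i_u dξ`, computed in the chart `φ` at `x`:
`dξ(u, v) = (D_{φ u} ξ')(φ v) - (D_{φ v} ξ')(φ u)`, where `ξ'` is the local representative and
`φ u`, `φ v` are the images of `u`, `v` under the differential of `φ`. -/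
def dForm (ξ : Π x : M, Cot EM x) (x : M) (u : Tan EM x) : Cot EM x :=
  let D : EM →L[ℝ] EM →L[ℝ] ℝ := fderiv ℝ (chartForm ξ x) (extChartAt 𝓘(ℝ, EM) x x)
  let dφ : Tan EM x →L[ℝ] EM := mfderiv 𝓘(ℝ, EM) 𝓘(ℝ, EM) (extChartAt 𝓘(ℝ, EM) x) x
  (D (dφ u) - D.flip (dφ u)).comp dφ

/-- The Lie derivative of a 1-form, `L_X ξ = i_X dξ + d(ξ(X))`. -/
def lieForm (X : Π x : M, Tan EM x) (ξ : Π x : M, Cot EM x) (x : M) : Cot EM x :=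
  dForm ξ x (X x) + dFun (fun y => ξ y (X y)) x

/-- The Lie derivative of a bivector field, evaluated on two 1-forms. The bivector field is given
by its sharp map `V`, so that its value on `(α, β)` is `β (V α)`, and
`(L_Y V)(α, β) = Y (V(α, β)) - V(L_Y α, β) - V(α, L_Y β)`. -/
def lieBivector (Y : Π x : M, Tan EM x) (V : Π x : M, Cot EM x → Tan EM x)
    (α β : Π x : M, Cot EM x) (x : M) : ℝ :=
  dFun (fun y => β y (V y (α y))) x (Y x) - β x (V x (lieForm Y α x)) - lieForm Y β x (V x (α x))

/-- A family of subspaces `D_x ⊆ T_x M` is a smooth sub-bundle of `TM`: near each point it has a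
smooth frame. -/
def IsSmoothDistribution [IsManifold 𝓘(ℝ, EM) ∞ M] (D : Π x : M, Submodule ℝ (Tan EM x)) : Prop :=
  ∀ x₀ : M, ∃ U ∈ 𝓝 x₀, ∃ (k : ℕ) (X : Fin k → Π x : M, Tan EM x),
    (∀ i, SmoothVFOn (X i) U) ∧
    ∀ x ∈ U, LinearIndependent ℝ (fun i => X i x) ∧
      Submodule.span ℝ (Set.range fun i => X i x) = D x

/-! ### Dirac structures -/

/-- The symmetric pairing on `T_x M ⊕ T*_x M`. -/
def pairing {x : M} (p q : Tan EM x × Cot EM x) : ℝ := (1 / 2) * (p.2 q.1 + q.2 p.1)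

/-- Isotropic subspaces of `T_x M ⊕ T*_x M`. -/
def IsIsotropic {x : M} (S : Submodule ℝ (Tan EM x × Cot EM x)) : Prop :=
  ∀ p ∈ S, ∀ q ∈ S, pairing p q = 0

/-- The Courant bracket
`[(X₁, ξ₁), (X₂, ξ₂)] = ([X₁, X₂], L_{X₁} ξ₂ - i_{X₂} dξ₁)`. -/
def courant (X₁ : Π x : M, Tan EM x) (ξ₁ : Π x : M, Cot EM x)
    (X₂ : Π x : M, Tan EM x) (ξ₂ : Π x : M, Cot EM x) (x : M) : Tan EM x × Cot EM x :=
  (VectorField.mlieBracket 𝓘(ℝ, EM) X₁ X₂ x, lieForm X₁ ξ₂ x - dForm ξ₁ x (X₂ x))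

/-- A family of subspaces `L_x ⊆ T_x M ⊕ T*_x M` is a smooth sub-bundle of `TM ⊕ T*M`: near each
point it has a smooth frame. -/
def IsSmoothSubbundle [IsManifold 𝓘(ℝ, EM) ∞ M]
    (L : Π x : M, Submodule ℝ (Tan EM x × Cot EM x)) : Prop :=
  ∀ x₀ : M, ∃ U ∈ 𝓝 x₀, ∃ (k : ℕ) (X : Fin k → Π x : M, Tan EM x) (ξ : Fin k → Π x : M, Cot EM x),
    (∀ i, SmoothVFOn (X i) U ∧ SmoothFormOn (ξ i) U) ∧
    ∀ x ∈ U, LinearIndependent ℝ (fun i => (X i x, ξ i x)) ∧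
      Submodule.span ℝ (Set.range fun i => (X i x, ξ i x)) = L x

/-- Dirac structures: maximally isotropic smooth sub-bundles of `TM ⊕ T*M` whose space of smooth
sections is closed under the Courant bracket. -/
structure IsDirac [IsManifold 𝓘(ℝ, EM) ∞ M]
    (L : Π x : M, Submodule ℝ (Tan EM x × Cot EM x)) : Prop where
  smooth : IsSmoothSubbundle L
  maximal : ∀ x, Maximal IsIsotropic (L x)
  closed : ∀ (X₁ : Π x : M, Tan EM x) (ξ₁ : Π x : M, Cot EM x)
    (X₂ : Π x : M, Tan EM x) (ξ₂ : Π x : M, Cot EM x),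
    SmoothVFOn X₁ Set.univ → SmoothFormOn ξ₁ Set.univ →
    SmoothVFOn X₂ Set.univ → SmoothFormOn ξ₂ Set.univ →
    (∀ x, (X₁ x, ξ₁ x) ∈ L x) → (∀ x, (X₂ x, ξ₂ x) ∈ L x) →
    ∀ x, courant X₁ ξ₁ X₂ ξ₂ x ∈ L x

end Calculus

/-! ## Poisson manifolds -/

/-- A Poisson structure on `M`: a smooth bivector field, given by its sharp map `T*M → TM`
(the bivector is `(α, β) ↦ β (sharp α)`, skew-symmetric), whose bracket `{f, g} = dg (sharp df)` on
smooth functions satisfies the Jacobi identity. -/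
structure PoissonStructure (EM : Type*) [NormedAddCommGroup EM] [NormedSpace ℝ EM]
    (M : Type*) [TopologicalSpace M] [ChartedSpace EM M] [IsManifold 𝓘(ℝ, EM) ∞ M] where
  sharp : Π x : M, Cot EM x →L[ℝ] Tan EM x
  smooth : ContMDiff 𝓘(ℝ, EM) (𝓘(ℝ, EM).prod 𝓘(ℝ, (EM →L[ℝ] ℝ) →L[ℝ] EM)) ∞
    (fun x => Bundle.TotalSpace.mk' ((EM →L[ℝ] ℝ) →L[ℝ] EM)
      (E := fun x : M => (TangentSpace 𝓘(ℝ, EM) x →L[ℝ] ℝ) →L[ℝ] TangentSpace 𝓘(ℝ, EM) x)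
      x (sharp x))
  skew : ∀ (x : M) (α β : Cot EM x), β (sharp x α) = - α (sharp x β)
  jacobi : ∀ f g h : M → ℝ, ContMDiff 𝓘(ℝ, EM) 𝓘(ℝ, ℝ) ∞ f → ContMDiff 𝓘(ℝ, EM) 𝓘(ℝ, ℝ) ∞ g →
    ContMDiff 𝓘(ℝ, EM) 𝓘(ℝ, ℝ) ∞ h →
    let br : (M → ℝ) → (M → ℝ) → M → ℝ := fun a b x => dFun b x (sharp x (dFun a x))
    ∀ x, br f (br g h) x + br g (br h f) x + br h (br f g) x = 0

section Bundle

variable {EM : Type*} [NormedAddCommGroup EM] [NormedSpace ℝ EM]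
  {BM : Type*} [NormedAddCommGroup BM] [NormedSpace ℝ BM]
  {FM : Type*} [NormedAddCommGroup FM] [NormedSpace ℝ FM]
  {E : Type*} [TopologicalSpace E] [ChartedSpace EM E] [IsManifold 𝓘(ℝ, EM) ∞ E]
  {B : Type*} [TopologicalSpace B] [ChartedSpace BM B] [IsManifold 𝓘(ℝ, BM) ∞ B]
  {F : Type*} [TopologicalSpace F] [ChartedSpace FM F] [IsManifold 𝓘(ℝ, FM) ∞ F]

/-- `f : F → F` is a Poisson isomorphism: a diffeomorphism with `f_* V = V`. -/
def PoissonStructure.IsPoissonIso (P : PoissonStructure FM F) (f : F → F) : Prop :=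
  (∃ Φ : F ≃ₘ^∞⟮𝓘(ℝ, FM), 𝓘(ℝ, FM)⟯ F, ⇑Φ = f) ∧
  ∀ (y : F) (α : Cot FM (f y)),
    mfderiv 𝓘(ℝ, FM) 𝓘(ℝ, FM) f y
      (P.sharp y (α.comp (mfderiv 𝓘(ℝ, FM) 𝓘(ℝ, FM) f y))) = P.sharp (f y) α

/-- The parametrization `y ↦ φ⁻¹(b, y)` of the fiber over `b` given by a local trivialization. -/
def fiberMap {π : E → B} (φ : Bundle.Trivialization F π) (b : B) (y : F) : E :=
  φ.toOpenPartialHomeomorph.symm (b, y)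

variable (EM BM) in
/-- A Poisson fiber bundle `π : E → B` with fiber the Poisson manifold `(F, P)`: the base is covered
by the domains of smooth local trivializations `π⁻¹(U) ≃ U × F` over `U`, and all transition maps
`φ'(b) ∘ φ(b)⁻¹ : F → F` are Poisson isomorphisms. -/
structure PoissonFiberBundle (π : E → B) (P : PoissonStructure FM F) where
  smooth_proj : ContMDiff 𝓘(ℝ, EM) 𝓘(ℝ, BM) ∞ π
  atlas : Set (Bundle.Trivialization F π)
  cover : ∀ b : B, ∃ φ ∈ atlas, b ∈ φ.baseSet
  smooth : ∀ φ ∈ atlas, ContMDiffOn 𝓘(ℝ, EM) (𝓘(ℝ, BM).prod 𝓘(ℝ, FM)) ∞ φ φ.source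
  smooth_symm : ∀ φ ∈ atlas, ContMDiffOn (𝓘(ℝ, BM).prod 𝓘(ℝ, FM)) 𝓘(ℝ, EM) ∞
    φ.toOpenPartialHomeomorph.symm φ.target
  transition : ∀ φ ∈ atlas, ∀ φ' ∈ atlas, ∀ b ∈ φ.baseSet, b ∈ φ'.baseSet →
    P.IsPoissonIso (fun y => (φ' (fiberMap φ b y)).2)

variable (EM BM) in
/-- The vertical space `Vert_e = ker (T_e π)`. -/
def vert (π : E → B) (e : E) : Submodule ℝ (Tan EM e) :=
  LinearMap.ker (mfderiv 𝓘(ℝ, EM) 𝓘(ℝ, BM) π e).toLinearMap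

/-- The annihilator in `T*_e E` of a subspace of `T_e E`. -/
def ann {e : E} (S : Submodule ℝ (Tan EM e)) : Submodule ℝ (Cot EM e) where
  carrier := {β | ∀ v ∈ S, β v = 0}
  add_mem' := by
    intro a b ha hb v hv
    simp [ha v hv, hb v hv]
  zero_mem' := by
    intro v _
    rfl
  smul_mem' := by
    intro c a ha v hv
    simp [ha v hv]

/-- `Y` is a `D`-horizontal lift of the vector field `X` on `B`. If `T_e E = D_e ⊕ Vert_e` for all
`e`, there is exactly one. -/
def IsHorizontalLift (π : E → B) (D : Π e : E, Submodule ℝ (Tan EM e))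
    (X : Π b : B, Tan BM b) (Y : Π e : E, Tan EM e) : Prop :=
  ∀ e, Y e ∈ D e ∧ mfderiv 𝓘(ℝ, EM) 𝓘(ℝ, BM) π e (Y e) = X (π e)

variable (EM BM) in
/-- An Ehresmann connection on `π : E → B`: a smooth sub-bundle `D` of `TE` with `TE = D ⊕ Vert`. -/
structure IsEhresmann (π : E → B) (D : Π e : E, Submodule ℝ (Tan EM e)) : Prop where
  smooth : IsSmoothDistribution D
  isCompl : ∀ e, IsCompl (D e) (vert EM BM π e)

namespace PoissonFiberBundle

variable {π : E → B} {P : PoissonStructure FM F}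

/-- The vertical Poisson bivector field on `E` (as a sharp map), coinciding with the Poisson
structures of the fibers. At `e`, let `φ` be a trivialization from the atlas at `b = π e`,
`i = φ(b)⁻¹ : F → E` and `y = φ(b)(e)`, so that `i y = e`; the value at `e` is the push-forward
`di_y ∘ sharp_y ∘ (di_y)*` of the Poisson structure of `F`. It does not depend on the choice of `φ`,
because the transition maps are Poisson isomorphisms. -/
def vertSharp (Q : PoissonFiberBundle EM BM π P) (e : E) (α : Cot EM e) : Tan EM e :=
  let φ := Classical.choose (Q.cover (π e))
  let y : F := (φ e).2
  let di : Tan FM y →L[ℝ] Tan EM e := mfderiv 𝓘(ℝ, FM) 𝓘(ℝ, EM) (fiberMap φ (π e)) y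
  di (P.sharp y (α.comp di))

/-- `L` restricts to the Poisson structures of the fibers. The fiber `E_b` is parametrized by
`i = φ(b)⁻¹ : F → E`. The structure induced by `L` on it at `y` consists of the pairs
`(w, v ∘ di_y)` with `(di_y w, v) ∈ L`; it has to be the graph `{(sharp a, a)}` of the Poisson
structure. -/
def RestrictsToFibers (Q : PoissonFiberBundle EM BM π P)
    (L : Π e : E, Submodule ℝ (Tan EM e × Cot EM e)) : Prop :=
  ∀ φ ∈ Q.atlas, ∀ b ∈ φ.baseSet, ∀ y : F,
    {p : Tan FM y × Cot FM y | ∃ v : Cot EM (fiberMap φ b y),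
      (mfderiv 𝓘(ℝ, FM) 𝓘(ℝ, EM) (fiberMap φ b) y p.1, v) ∈ L (fiberMap φ b y) ∧
      p.2 = v.comp (mfderiv 𝓘(ℝ, FM) 𝓘(ℝ, EM) (fiberMap φ b) y)} =
    {p : Tan FM y × Cot FM y | p.1 = P.sharp y p.2}

/-- `L` is a Dirac structure on `E` that restricts to the Poisson structures of the fibers and
satisfies `L ∩ (Vert ⊕ Ann(Vert)) = 0`. -/
structure IsCoherentDirac (Q : PoissonFiberBundle EM BM π P)
    (L : Π e : E, Submodule ℝ (Tan EM e × Cot EM e)) : Prop where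
  dirac : IsDirac L
  restricts : Q.RestrictsToFibers L
  transverse : ∀ e, L e ⊓ (vert EM BM π e).prod (ann (vert EM BM π e)) = ⊥

/-- Coherent Poisson fiber bundles. -/
def IsCoherent (Q : PoissonFiberBundle EM BM π P) : Prop :=
  ∃ L : Π e : E, Submodule ℝ (Tan EM e × Cot EM e), Q.IsCoherentDirac L

/-- Poisson-Ehresmann connections: Ehresmann connections such that the Lie derivative of the
vertical Poisson bivector field along the (unique, smooth) horizontal lift of each smooth vector
field on `B` vanishes. -/
structure IsPoissonEhresmann (Q : PoissonFiberBundle EM BM π P)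
    (D : Π e : E, Submodule ℝ (Tan EM e)) : Prop where
  ehresmann : IsEhresmann EM BM π D
  poisson : ∀ X : Π b : B, Tan BM b, SmoothVFOn X Set.univ →
    ∃ Y : Π e : E, Tan EM e, SmoothVFOn Y Set.univ ∧ IsHorizontalLift π D X Y ∧
      ∀ α β : Π e : E, Cot EM e, SmoothFormOn α Set.univ → SmoothFormOn β Set.univ →
        ∀ e, lieBivector Y Q.vertSharp α β e = 0

end PoissonFiberBundle

variable (BM) in
/-- The distribution `H_e(L) = {Y | (Y, β) ∈ L_e for some β ∈ Ann(Vert_e)}`. -/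
def horDist (π : E → B) (L : Π e : E, Submodule ℝ (Tan EM e × Cot EM e)) (e : E) :
    Submodule ℝ (Tan EM e) where
  carrier := {Y | ∃ β ∈ ann (vert EM BM π e), (Y, β) ∈ L e}
  add_mem' := by
    rintro a b ⟨β, hβ, h⟩ ⟨γ, hγ, h'⟩
    exact ⟨β + γ, add_mem hβ hγ, add_mem h h'⟩
  zero_mem' := ⟨0, zero_mem _, zero_mem _⟩
  smul_mem' := by
    rintro c a ⟨β, hβ, h⟩
    exact ⟨c • β, Submodule.smul_mem _ c hβ, Submodule.smul_mem _ c h⟩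

end Bundle

end PoissonGeom

end

/-!
Write `C = Vert ⊕ Ann Vert`, a Lagrangian subspace of `TE ⊕ T*E` at each point; the transversality
of `L` is `L ∩ C = 0`. A vector orthogonal to `L` and to `C` lies in `C`, hence is isotropic, hence
lies in `L` by maximality, hence is zero; so `TE ⊕ T*E = L ⊕ C` (`exists_mem_sub_mem`). In other
words, an element of `L` is determined by its class in `TE / Vert ⊕ Vert*`, and every class occurs.
This isomorphism of bundles is smooth, as its inverse solves a smooth family of linear equations
(`smooth_of_smooth_class`). The classes in `TE / Vert` give `H(L)` and the horizontal lifts; hence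
`TE = H(L) ⊕ Vert`, the lifts are smooth, and so is `H(L)`. The classes `α|Vert` in `Vert*` give, as
`L` restricts to the Poisson structures of the fibers, the elements `(𝒱 α, α')` of `L`, where `α'`
agrees with `α` on `Vert` (`IsCoherentDirac.vertSharp_mem`).

Let `(Y, β)` be the section of `L` belonging to the horizontal lift `Y` of a field on `B`, with
`β` in `Ann Vert`, and let `U = 𝒱 α` and `W = 𝒱 γ`. The bracket of `Y`, or of a vertical field, with
a vertical field is vertical (`mlieBracket_mem_vert`). With Cartan's formula
`(L_Y ξ)(Z) = Y(ξ(Z)) - ξ([Y, Z])` and skew-symmetry of `𝒱` this gives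
`(L_Y 𝒱)(α, γ) = (L_Y α')(W) + γ'([Y, U])`, and it gives `dβ(U, W) = 0`. So `(L_Y 𝒱)(α, γ)` is
twice the pairing of the Courant bracket of `(Y, β)` and `(U, α')` with `(W, γ')`. The bracket is a
section of `L`, as `L` is involutive, and `L` is isotropic, so the pairing vanishes.
-/

noncomputable section

namespace PoissonGeom

/-! ### Vector fields and 1-forms in charts -/

section Charts

variable {EM : Type*} [NormedAddCommGroup EM] [NormedSpace ℝ EM]
variable {M : Type*} [TopologicalSpace M] [ChartedSpace EM M]

/-- The differential at `x` of the chart at `x₀`, with values in the model space. -/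
def chartD (x₀ x : M) : Tan EM x →L[ℝ] EM :=
  mfderiv 𝓘(ℝ, EM) 𝓘(ℝ, EM) (extChartAt 𝓘(ℝ, EM) x₀) x

/-- The differential of the inverse of the chart at `x₀`, at the image of `x`. It is the inverse of
`chartD x₀ x` when `x` lies in the chart domain. -/
def chartDinv (x₀ x : M) : EM →L[ℝ] Tan EM x :=
  mfderiv 𝓘(ℝ, EM) 𝓘(ℝ, EM) (extChartAt 𝓘(ℝ, EM) x₀).symm (extChartAt 𝓘(ℝ, EM) x₀ x)

/-- In terms of `chartDinv`, the local representative of a 1-form at the image of `x`. -/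
theorem chartForm_extChartAt (ξ : Π x : M, Cot EM x) {x₀ x : M}
    (hx : x ∈ (chartAt EM x₀).source) :
    chartForm ξ x₀ (extChartAt 𝓘(ℝ, EM) x₀ x) = (ξ x).comp (chartDinv x₀ x) := by
  have h2 : (extChartAt 𝓘(ℝ, EM) x₀).symm (extChartAt 𝓘(ℝ, EM) x₀ x) = x :=
    (extChartAt 𝓘(ℝ, EM) x₀).left_inv (by simpa using hx)
  unfold chartForm chartDinv
  congr 1
  rw [h2]

theorem eventually_mem_chart_source_symm (x₀ : M) :
    ∀ᶠ y in 𝓝 (extChartAt 𝓘(ℝ, EM) x₀ x₀), y ∈ (extChartAt 𝓘(ℝ, EM) x₀).target ∧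
      (extChartAt 𝓘(ℝ, EM) x₀).symm y ∈ (chartAt EM x₀).source := by
  filter_upwards [extChartAt_target_mem_nhds (I := 𝓘(ℝ, EM)) x₀] with y hy
  exact ⟨hy, by simpa using (extChartAt 𝓘(ℝ, EM) x₀).map_target hy⟩

variable [IsManifold 𝓘(ℝ, EM) ∞ M]

/-- The differential of the chart at `x₀` is the preferred trivialization of the tangent bundle
there, so that smoothness of sections can be tested with `chartD` and `chartDinv`. -/
theorem chartD_eq {x₀ x : M} (hx : x ∈ (chartAt EM x₀).source) :
    haveI : IsManifold 𝓘(ℝ, EM) 1 M := .of_le (n := ∞) (by simp)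
    chartD x₀ x =
      (trivializationAt EM (TangentSpace 𝓘(ℝ, EM) (M := M)) x₀).continuousLinearMapAt ℝ x := by
  have : IsManifold 𝓘(ℝ, EM) 1 M := .of_le (n := ∞) (by simp)
  exact (TangentBundle.continuousLinearMapAt_trivializationAt hx).symm

theorem chartDinv_eq {x₀ x : M} (hx : x ∈ (chartAt EM x₀).source) :
    haveI : IsManifold 𝓘(ℝ, EM) 1 M := .of_le (n := ∞) (by simp)
    chartDinv x₀ x = (trivializationAt EM (TangentSpace 𝓘(ℝ, EM) (M := M)) x₀).symmL ℝ x := by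
  have : IsManifold 𝓘(ℝ, EM) 1 M := .of_le (n := ∞) (by simp)
  rw [TangentBundle.symmL_trivializationAt hx]
  simp only [chartDinv, modelWithCornersSelf_coe, Set.range_id, mfderivWithin_univ]
  rfl

theorem chartD_chartDinv {x₀ x : M} (hx : x ∈ (chartAt EM x₀).source) (v : EM) :
    chartD x₀ x (chartDinv x₀ x v) = v := by
  have : IsManifold 𝓘(ℝ, EM) 1 M := .of_le (n := ∞) (by simp)
  rw [chartD_eq hx, chartDinv_eq hx]
  exact (trivializationAt EM (TangentSpace 𝓘(ℝ, EM) (M := M)) x₀).continuousLinearMapAt_symmL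
    (R := ℝ) (by simpa using hx) v

theorem chartDinv_chartD {x₀ x : M} (hx : x ∈ (chartAt EM x₀).source) (v : Tan EM x) :
    chartDinv x₀ x (chartD x₀ x v) = v := by
  have : IsManifold 𝓘(ℝ, EM) 1 M := .of_le (n := ∞) (by simp)
  rw [chartD_eq hx, chartDinv_eq hx]
  exact (trivializationAt EM (TangentSpace 𝓘(ℝ, EM) (M := M)) x₀).symmL_continuousLinearMapAt
    (R := ℝ) (by simpa using hx) v

theorem inverse_chartDinv {x₀ x : M} (hx : x ∈ (chartAt EM x₀).source) :
    ContinuousLinearMap.inverse (chartDinv (EM := EM) x₀ x) = chartD x₀ x :=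
  ContinuousLinearMap.inverse_eq (ContinuousLinearMap.ext (chartDinv_chartD hx))
    (ContinuousLinearMap.ext (chartD_chartDinv hx))

theorem inverse_chartD {x₀ x : M} (hx : x ∈ (chartAt EM x₀).source) :
    ContinuousLinearMap.inverse (chartD (EM := EM) x₀ x) = chartDinv x₀ x :=
  ContinuousLinearMap.inverse_eq (ContinuousLinearMap.ext (chartD_chartDinv hx))
    (ContinuousLinearMap.ext (chartDinv_chartD hx))

/-- The vector field `X` is smooth at `x₀`. -/
def SmoothVFAt (X : Π x : M, Tan EM x) (x₀ : M) : Prop :=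
  ContMDiffAt 𝓘(ℝ, EM) (𝓘(ℝ, EM).prod 𝓘(ℝ, EM)) ∞
    (fun x => Bundle.TotalSpace.mk' EM (E := fun x : M => TangentSpace 𝓘(ℝ, EM) x) x (X x)) x₀

/-- The 1-form `ξ` is smooth at `x₀`. -/
def SmoothFormAt (ξ : Π x : M, Cot EM x) (x₀ : M) : Prop :=
  ContMDiffAt 𝓘(ℝ, EM) (𝓘(ℝ, EM).prod 𝓘(ℝ, EM →L[ℝ] ℝ)) ∞
    (fun x => Bundle.TotalSpace.mk' (EM →L[ℝ] ℝ)
      (E := fun x : M => TangentSpace 𝓘(ℝ, EM) x →L[ℝ] ℝ) x (ξ x)) x₀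

theorem SmoothVFOn.smoothVFAt {X : Π x : M, Tan EM x} {U : Set M} (h : SmoothVFOn X U) {x : M}
    (hU : U ∈ 𝓝 x) : SmoothVFAt X x :=
  ContMDiffOn.contMDiffAt h hU

theorem SmoothFormOn.smoothFormAt {ξ : Π x : M, Cot EM x} {U : Set M} (h : SmoothFormOn ξ U)
    {x : M} (hU : U ∈ 𝓝 x) : SmoothFormAt ξ x :=
  ContMDiffOn.contMDiffAt h hU

theorem smoothVFAt_iff {X : Π x : M, Tan EM x} {x₀ : M} :
    SmoothVFAt X x₀ ↔
      ContMDiffAt 𝓘(ℝ, EM) 𝓘(ℝ, EM) ∞ (fun x => chartD x₀ x (X x)) x₀ := by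
  unfold SmoothVFAt
  rw [Bundle.contMDiffAt_section]
  refine Filter.EventuallyEq.contMDiffAt_iff ?_
  filter_upwards [chart_source_mem_nhds EM x₀] with x hx
  rw [chartD_eq hx, Bundle.Trivialization.continuousLinearMapAt_apply,
    Bundle.Trivialization.linearMapAt_apply, if_pos (by simpa using hx)]

theorem smoothFormAt_iff {ξ : Π x : M, Cot EM x} {x₀ : M} :
    SmoothFormAt ξ x₀ ↔
      ContMDiffAt 𝓘(ℝ, EM) 𝓘(ℝ, EM →L[ℝ] ℝ) ∞ (fun x => (ξ x).comp (chartDinv x₀ x)) x₀ := by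
  unfold SmoothFormAt
  rw [Bundle.contMDiffAt_section]
  refine Filter.EventuallyEq.contMDiffAt_iff ?_
  filter_upwards [chart_source_mem_nhds EM x₀] with x hx
  rw [hom_trivializationAt_apply, chartDinv_eq hx]
  ext v
  simp [ContinuousLinearMap.inCoordinates]

theorem SmoothVFAt.zero (x₀ : M) : SmoothVFAt (fun x : M => (0 : Tan EM x)) x₀ := by
  rw [smoothVFAt_iff]
  simp only [map_zero]
  exact contMDiffAt_const

theorem SmoothFormAt.zero (x₀ : M) : SmoothFormAt (fun x : M => (0 : Cot EM x)) x₀ := by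
  rw [smoothFormAt_iff]
  simp only [ContinuousLinearMap.zero_comp]
  exact contMDiffAt_const

/-- The contraction of a smooth 1-form with a smooth vector field is smooth. -/
theorem SmoothFormAt.apply {ξ : Π x : M, Cot EM x} {X : Π x : M, Tan EM x} {x₀ : M}
    (hξ : SmoothFormAt ξ x₀) (hX : SmoothVFAt X x₀) :
    ContMDiffAt 𝓘(ℝ, EM) 𝓘(ℝ, ℝ) ∞ (fun x => ξ x (X x)) x₀ := by
  rw [smoothFormAt_iff] at hξ
  rw [smoothVFAt_iff] at hX
  refine (hξ.clm_apply hX).congr_of_eventuallyEq ?_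
  filter_upwards [chart_source_mem_nhds EM x₀] with x hx
  simp [chartDinv_chartD hx]

section Model

variable {W : Type*} [NormedAddCommGroup W] [NormedSpace ℝ W]

theorem contDiffAt_comp_extChartAt_symm {f : M → W} {x₀ : M}
    (hf : ContMDiffAt 𝓘(ℝ, EM) 𝓘(ℝ, W) ∞ f x₀) :
    ContDiffAt ℝ ∞ (fun y => f ((extChartAt 𝓘(ℝ, EM) x₀).symm y)) (extChartAt 𝓘(ℝ, EM) x₀ x₀) := by
  rw [← contMDiffAt_iff_contDiffAt]
  have h : ContMDiffAt 𝓘(ℝ, EM) 𝓘(ℝ, EM) ∞ (extChartAt 𝓘(ℝ, EM) x₀).symm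
      (extChartAt 𝓘(ℝ, EM) x₀ x₀) :=
    (contMDiffOn_extChartAt_symm x₀).contMDiffAt (extChartAt_target_mem_nhds x₀)
  refine ContMDiffAt.comp (I' := 𝓘(ℝ, EM)) _ ?_ h
  rwa [extChartAt_to_inv]

theorem mfderiv_eq_fderiv_comp_chartD {f : M → W} {x₀ : M}
    (hf : ContMDiffAt 𝓘(ℝ, EM) 𝓘(ℝ, W) ∞ f x₀) (v : Tan EM x₀) :
    mfderiv 𝓘(ℝ, EM) 𝓘(ℝ, W) f x₀ v =
      fderiv ℝ (fun y => f ((extChartAt 𝓘(ℝ, EM) x₀).symm y)) (extChartAt 𝓘(ℝ, EM) x₀ x₀)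
        (chartD x₀ x₀ v) := by
  have hd := (contDiffAt_comp_extChartAt_symm hf).differentiableAt (by simp)
  have he : f =ᶠ[𝓝 x₀] (fun y => f ((extChartAt 𝓘(ℝ, EM) x₀).symm y)) ∘ extChartAt 𝓘(ℝ, EM) x₀ := by
    filter_upwards [chart_source_mem_nhds EM x₀] with x hx
    simp only [Function.comp]
    rw [(extChartAt 𝓘(ℝ, EM) x₀).left_inv (by simpa using hx)]
  have hc : MDifferentiableAt 𝓘(ℝ, EM) 𝓘(ℝ, EM) (extChartAt 𝓘(ℝ, EM) x₀) x₀ :=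
    mdifferentiableAt_extChartAt (by simp)
  rw [he.mfderiv_eq, mfderiv_comp (I' := 𝓘(ℝ, EM)) x₀ hd.mdifferentiableAt hc, mfderiv_eq_fderiv]
  rfl

end Model

/-- The representative of a Lie bracket in the chart at the base point is the bracket of the
representatives. -/
theorem chartD_mlieBracket {X Z : Π x : M, Tan EM x} {x₀ : M} :
    chartD x₀ x₀ (VectorField.mlieBracket 𝓘(ℝ, EM) X Z x₀) =
      VectorField.lieBracket ℝ
        (fun y => chartD x₀ ((extChartAt 𝓘(ℝ, EM) x₀).symm y) (X ((extChartAt 𝓘(ℝ, EM) x₀).symm y)))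
        (fun y => chartD x₀ ((extChartAt 𝓘(ℝ, EM) x₀).symm y) (Z ((extChartAt 𝓘(ℝ, EM) x₀).symm y)))
        (extChartAt 𝓘(ℝ, EM) x₀ x₀) := by
  have key : ∀ V : Π x : M, Tan EM x, VectorField.mpullbackWithin 𝓘(ℝ, EM) 𝓘(ℝ, EM)
      (extChartAt 𝓘(ℝ, EM) x₀).symm V Set.univ =ᶠ[𝓝 (extChartAt 𝓘(ℝ, EM) x₀ x₀)]
      (fun y => chartD x₀ ((extChartAt 𝓘(ℝ, EM) x₀).symm y)
        (V ((extChartAt 𝓘(ℝ, EM) x₀).symm y)) : EM → EM) := by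
    intro V
    filter_upwards [eventually_mem_chart_source_symm x₀] with y hy
    rw [VectorField.mpullbackWithin_apply, mfderivWithin_univ]
    have e : mfderiv 𝓘(ℝ, EM) 𝓘(ℝ, EM) (extChartAt 𝓘(ℝ, EM) x₀).symm y =
        chartDinv (EM := EM) x₀ ((extChartAt 𝓘(ℝ, EM) x₀).symm y) := by
      unfold chartDinv
      rw [(extChartAt 𝓘(ℝ, EM) x₀).right_inv hy.1]
    have e' : (mfderiv 𝓘(ℝ, EM) 𝓘(ℝ, EM) (extChartAt 𝓘(ℝ, EM) x₀).symm y).inverse =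
        chartD (EM := EM) x₀ ((extChartAt 𝓘(ℝ, EM) x₀).symm y) := by
      rw [e]
      exact inverse_chartDinv (EM := EM) hy.2
    rw [e']
    rfl
  have hinv : (mfderiv 𝓘(ℝ, EM) 𝓘(ℝ, EM) (extChartAt 𝓘(ℝ, EM) x₀) x₀).inverse =
      chartDinv (EM := EM) x₀ x₀ :=
    inverse_chartD (EM := EM) (mem_chart_source EM x₀)
  unfold VectorField.mlieBracket
  rw [VectorField.mlieBracketWithin_apply, hinv]
  simp only [modelWithCornersSelf_coe, Set.range_id, Set.preimage_univ, Set.univ_inter]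
  refine (chartD_chartDinv (EM := EM) (mem_chart_source EM x₀) _).trans ?_
  refine (congrFun VectorField.lieBracketWithin_univ _).trans ?_
  exact (key X).lieBracket_vectorField_eq (key Z)

end Charts

/-! ### Cartan's formula and vertical vector fields -/

section Cartan

variable {EM : Type*} [NormedAddCommGroup EM] [NormedSpace ℝ EM]
variable {M : Type*} [TopologicalSpace M] [ChartedSpace EM M] [IsManifold 𝓘(ℝ, EM) ∞ M]

theorem SmoothFormAt.contDiffAt_chartForm {ξ : Π x : M, Cot EM x} {x₀ : M}
    (hξ : SmoothFormAt ξ x₀) :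
    ContDiffAt ℝ ∞ (chartForm ξ x₀) (extChartAt 𝓘(ℝ, EM) x₀ x₀) := by
  refine (contDiffAt_comp_extChartAt_symm (smoothFormAt_iff.1 hξ)).congr_of_eventuallyEq ?_
  filter_upwards [eventually_mem_chart_source_symm x₀] with y hy
  rw [← chartForm_extChartAt ξ hy.2, (extChartAt 𝓘(ℝ, EM) x₀).right_inv hy.1]

/-- Cartan's formula `dξ(X, Z) = X(ξ(Z)) - Z(ξ(X)) - ξ([X, Z])`. -/
theorem dForm_apply_vectorField {ξ : Π x : M, Cot EM x} {X Z : Π x : M, Tan EM x} {x₀ : M}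
    (hξ : SmoothFormAt ξ x₀) (hX : SmoothVFAt X x₀) (hZ : SmoothVFAt Z x₀) :
    dForm ξ x₀ (X x₀) (Z x₀) =
      dFun (fun x => ξ x (Z x)) x₀ (X x₀) - dFun (fun x => ξ x (X x)) x₀ (Z x₀) -
        ξ x₀ (VectorField.mlieBracket 𝓘(ℝ, EM) X Z x₀) := by
  have hs := mem_chart_source EM x₀
  set y₀ := extChartAt 𝓘(ℝ, EM) x₀ x₀ with hy₀
  have hy : (extChartAt 𝓘(ℝ, EM) x₀).symm y₀ = x₀ := extChartAt_to_inv x₀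
  -- the representatives in the chart at `x₀`
  let c : (Π x : M, Tan EM x) → EM → EM := fun V y =>
    chartD x₀ ((extChartAt 𝓘(ℝ, EM) x₀).symm y) (V ((extChartAt 𝓘(ℝ, EM) x₀).symm y))
  have hc : ∀ V : Π x : M, Tan EM x, c V y₀ = chartD x₀ x₀ (V x₀) := fun V =>
    congrArg (fun x => chartD x₀ x (V x)) hy
  have hcd : ∀ V : Π x : M, Tan EM x, SmoothVFAt V x₀ → DifferentiableAt ℝ (c V) y₀ :=
    fun V hV => (contDiffAt_comp_extChartAt_symm (smoothVFAt_iff.1 hV)).differentiableAt (by simp)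
  have hξd : DifferentiableAt ℝ (chartForm ξ x₀) y₀ :=
    hξ.contDiffAt_chartForm.differentiableAt (by simp)
  -- the product rule for the pairing, read in the chart
  have hpair : ∀ V W : Π x : M, Tan EM x, SmoothVFAt V x₀ →
      dFun (fun x => ξ x (V x)) x₀ (W x₀) =
        fderiv ℝ (chartForm ξ x₀) y₀ (c W y₀) (c V y₀) +
          chartForm ξ x₀ y₀ (fderiv ℝ (c V) y₀ (c W y₀)) := by
    intro V W hV
    have h1 := mfderiv_eq_fderiv_comp_chartD (hξ.apply hV) (W x₀)
    have h2 : (fun y => ξ ((extChartAt 𝓘(ℝ, EM) x₀).symm y) (V ((extChartAt 𝓘(ℝ, EM) x₀).symm y)))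
        =ᶠ[𝓝 y₀] fun y => chartForm ξ x₀ y (c V y) := by
      filter_upwards [eventually_mem_chart_source_symm x₀] with y hy
      have := chartForm_extChartAt ξ hy.2
      rw [(extChartAt 𝓘(ℝ, EM) x₀).right_inv hy.1] at this
      rw [this]
      exact (congrArg (ξ _) (chartDinv_chartD hy.2 _)).symm
    rw [h2.fderiv_eq, fderiv_clm_apply hξd (hcd V hV), ← hc] at h1
    refine h1.trans ?_
    exact add_comm _ _
  have hbr : ξ x₀ (VectorField.mlieBracket 𝓘(ℝ, EM) X Z x₀) =
      chartForm ξ x₀ y₀ (fderiv ℝ (c Z) y₀ (c X y₀) - fderiv ℝ (c X) y₀ (c Z y₀)) := by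
    have h1 := chartD_mlieBracket (X := X) (Z := Z) (x₀ := x₀)
    have h2 : chartForm ξ x₀ y₀ = (ξ x₀).comp (chartDinv x₀ x₀) := chartForm_extChartAt ξ hs
    rw [h2, ← chartDinv_chartD hs (VectorField.mlieBracket 𝓘(ℝ, EM) X Z x₀), h1]
    rfl
  rw [hbr, hpair Z X hZ, hpair X Z hX, map_sub]
  have : dForm ξ x₀ (X x₀) (Z x₀) = fderiv ℝ (chartForm ξ x₀) y₀ (c X y₀) (c Z y₀) -
      fderiv ℝ (chartForm ξ x₀) y₀ (c Z y₀) (c X y₀) := by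
    rw [hc, hc]
    rfl
  rw [this]
  ring

/-- The Leibniz rule `(L_X ξ)(Z) = X(ξ(Z)) - ξ([X, Z])`. -/
theorem lieForm_apply_vectorField {ξ : Π x : M, Cot EM x} {X Z : Π x : M, Tan EM x} {x₀ : M}
    (hξ : SmoothFormAt ξ x₀) (hX : SmoothVFAt X x₀) (hZ : SmoothVFAt Z x₀) :
    lieForm X ξ x₀ (Z x₀) =
      dFun (fun x => ξ x (Z x)) x₀ (X x₀) - ξ x₀ (VectorField.mlieBracket 𝓘(ℝ, EM) X Z x₀) := by
  unfold lieForm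
  rw [add_apply, dForm_apply_vectorField hξ hX hZ]
  ring

theorem chartForm_dFun {f : M → ℝ} {x₀ : M} (hf : ContMDiffAt 𝓘(ℝ, EM) 𝓘(ℝ, ℝ) ∞ f x₀) :
    chartForm (dFun f) x₀ =ᶠ[𝓝 (extChartAt 𝓘(ℝ, EM) x₀ x₀)]
      fderiv ℝ (fun y => f ((extChartAt 𝓘(ℝ, EM) x₀).symm y)) := by
  have h1 : ∀ᶠ x in 𝓝 x₀, MDifferentiableAt 𝓘(ℝ, EM) 𝓘(ℝ, ℝ) f x := by
    filter_upwards [(contMDiffAt_iff_contMDiffAt_nhds (n := 1) (by simp)).1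
      (hf.of_le (by simp))] with x hx
    exact hx.mdifferentiableAt (by simp)
  have h2 : Filter.Tendsto (extChartAt 𝓘(ℝ, EM) x₀).symm
      (𝓝 (extChartAt 𝓘(ℝ, EM) x₀ x₀)) (𝓝 x₀) := by
    have := (continuousAt_extChartAt_symm (I := 𝓘(ℝ, EM)) x₀).tendsto
    rwa [extChartAt_to_inv] at this
  filter_upwards [h2.eventually h1, extChartAt_target_mem_nhds (I := 𝓘(ℝ, EM)) x₀] with y hy hy'
  have h3 : MDifferentiableAt 𝓘(ℝ, EM) 𝓘(ℝ, EM) (extChartAt 𝓘(ℝ, EM) x₀).symm y :=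
    ((contMDiffOn_extChartAt_symm (I := 𝓘(ℝ, EM)) (n := ∞) x₀).contMDiffAt
      ((isOpen_extChartAt_target x₀).mem_nhds hy')).mdifferentiableAt (by simp)
  rw [← mfderiv_eq_fderiv]
  exact (mfderiv_comp (I' := 𝓘(ℝ, EM)) y hy h3).symm

theorem smoothFormAt_dFun {f : M → ℝ} {x₀ : M} (hf : ContMDiffAt 𝓘(ℝ, EM) 𝓘(ℝ, ℝ) ∞ f x₀) :
    SmoothFormAt (dFun (EM := EM) f) x₀ := by
  rw [smoothFormAt_iff]
  have h1 : ContDiffAt ℝ ∞ (chartForm (dFun f) x₀) (extChartAt 𝓘(ℝ, EM) x₀ x₀) :=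
    ((contDiffAt_comp_extChartAt_symm hf).fderiv_right (m := ∞) (by simp)).congr_of_eventuallyEq
      (chartForm_dFun hf)
  refine ((contMDiffAt_iff_contDiffAt.2 h1).comp (I' := 𝓘(ℝ, EM)) x₀
    contMDiffAt_extChartAt).congr_of_eventuallyEq ?_
  filter_upwards [chart_source_mem_nhds EM x₀] with x hx
  exact (chartForm_extChartAt _ hx).symm

/-- An exact 1-form is closed. -/
theorem dForm_dFun {f : M → ℝ} {x₀ : M} (hf : ContMDiffAt 𝓘(ℝ, EM) 𝓘(ℝ, ℝ) ∞ f x₀)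
    (u v : Tan EM x₀) : dForm (dFun f) x₀ u v = 0 := by
  have h := (contDiffAt_comp_extChartAt_symm hf).isSymmSndFDerivAt (n := ∞)
    (by simpa using WithTop.coe_le_coe.2 (le_top : (2 : ℕ∞) ≤ ⊤))
  have : fderiv ℝ (chartForm (dFun f) x₀) (extChartAt 𝓘(ℝ, EM) x₀ x₀) = _ :=
    (chartForm_dFun hf).fderiv_eq
  unfold dForm
  rw [this]
  exact sub_eq_zero.2 (h _ _)

end Cartan

section Vertical

variable {EM : Type*} [NormedAddCommGroup EM] [NormedSpace ℝ EM]
  {BM : Type*} [NormedAddCommGroup BM] [NormedSpace ℝ BM]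
  {E : Type*} [TopologicalSpace E] [ChartedSpace EM E]
  {B : Type*} [TopologicalSpace B] [ChartedSpace BM B]

theorem mem_vert {π : E → B} {e : E} {v : Tan EM e} :
    v ∈ vert EM BM π e ↔ mfderiv 𝓘(ℝ, EM) 𝓘(ℝ, BM) π e v = 0 := Iff.rfl

variable [IsManifold 𝓘(ℝ, EM) ∞ E] [IsManifold 𝓘(ℝ, BM) ∞ B]

/-- The bracket of a vector field that projects to the base with a vertical one is vertical. This is
Cartan's formula for the closed forms `d(ℓ ∘ ψ ∘ π)`, where `ψ` is the chart of the base at `π e₀`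
and `ℓ` is a linear functional: these forms kill the vertical field, and their values on the other
one are functions pulled back from the base, whose vertical derivatives vanish. -/
theorem mlieBracket_mem_vert {π : E → B} (hπ : ContMDiff 𝓘(ℝ, EM) 𝓘(ℝ, BM) ∞ π)
    {X : Π b : B, Tan BM b} {Y W : Π e : E, Tan EM e} {e₀ : E} (hX : SmoothVFAt X (π e₀))
    (hY : SmoothVFAt Y e₀) (hW : SmoothVFAt W e₀)
    (hYX : ∀ e, mfderiv 𝓘(ℝ, EM) 𝓘(ℝ, BM) π e (Y e) = X (π e))
    (hWv : ∀ e, W e ∈ vert EM BM π e) :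
    VectorField.mlieBracket 𝓘(ℝ, EM) Y W e₀ ∈ vert EM BM π e₀ := by
  set b₀ := π e₀
  have hc : ContMDiffAt 𝓘(ℝ, BM) 𝓘(ℝ, BM) ∞ (extChartAt 𝓘(ℝ, BM) b₀) b₀ := contMDiffAt_extChartAt
  have hd : ∀ (ℓ : BM →L[ℝ] ℝ) (e : E), π e ∈ (chartAt BM b₀).source → ∀ v : Tan EM e,
      dFun (EM := EM) (fun e => ℓ (extChartAt 𝓘(ℝ, BM) b₀ (π e))) e v =
        ℓ (chartD b₀ (π e) (mfderiv 𝓘(ℝ, EM) 𝓘(ℝ, BM) π e v)) := by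
    intro ℓ e he v
    have h1 : MDifferentiableAt 𝓘(ℝ, BM) 𝓘(ℝ, BM) (extChartAt 𝓘(ℝ, BM) b₀) (π e) :=
      mdifferentiableAt_extChartAt he
    have h2 : MDifferentiableAt 𝓘(ℝ, EM) 𝓘(ℝ, BM) π e := (hπ e).mdifferentiableAt (by simp)
    have h3 := ℓ.hasMFDerivAt (x := extChartAt 𝓘(ℝ, BM) b₀ (π e))
    have h4 := h3.comp e (h1.hasMFDerivAt.comp e h2.hasMFDerivAt)
    have := h4.mfderiv
    unfold dFun
    exact congrArg (fun f => f v) this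
  have key : ∀ ℓ : BM →L[ℝ] ℝ, ℓ (chartD b₀ b₀ (mfderiv 𝓘(ℝ, EM) 𝓘(ℝ, BM) π e₀
      (VectorField.mlieBracket 𝓘(ℝ, EM) Y W e₀))) = 0 := by
    intro ℓ
    let f : E → ℝ := fun e => ℓ (extChartAt 𝓘(ℝ, BM) b₀ (π e))
    have hf : ContMDiffAt 𝓘(ℝ, EM) 𝓘(ℝ, ℝ) ∞ f e₀ :=
      ℓ.contMDiff.contMDiffAt.comp e₀ (hc.comp e₀ (hπ e₀))
    have hnear : ∀ᶠ e in 𝓝 e₀, π e ∈ (chartAt BM b₀).source :=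
      (hπ e₀).continuousAt.eventually (chart_source_mem_nhds BM b₀)
    have h1 := dForm_apply_vectorField (smoothFormAt_dFun hf) hY hW
    rw [dForm_dFun hf] at h1
    have h2 : dFun (EM := EM) (fun e => dFun f e (W e)) e₀ (Y e₀) = 0 := by
      have : (fun e => dFun f e (W e)) =ᶠ[𝓝 e₀] fun _ => (0 : ℝ) := by
        filter_upwards [hnear] with e he
        rw [hd ℓ e he, mem_vert.1 (hWv e)]
        simp
      unfold dFun at this ⊢
      rw [this.mfderiv_eq, mfderiv_const]
      rfl
    have h3 : dFun (EM := EM) (fun e => dFun f e (Y e)) e₀ (W e₀) = 0 := by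
      have h : (fun e => dFun f e (Y e)) =ᶠ[𝓝 e₀]
          (fun b => ℓ (chartD b₀ b (X b))) ∘ π := by
        filter_upwards [hnear] with e he
        rw [hd ℓ e he, hYX]
        rfl
      have hg : MDifferentiableAt 𝓘(ℝ, BM) 𝓘(ℝ, ℝ) (fun b => ℓ (chartD b₀ b (X b))) b₀ :=
        (ℓ.contMDiff.contMDiffAt.comp b₀ (smoothVFAt_iff.1 hX)).mdifferentiableAt (n := ∞) (by simp)
      unfold dFun at h ⊢
      rw [h.mfderiv_eq, mfderiv_comp e₀ hg ((hπ e₀).mdifferentiableAt (by simp))]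
      exact (congrArg (mfderiv 𝓘(ℝ, BM) 𝓘(ℝ, ℝ) _ b₀) (mem_vert.1 (hWv e₀))).trans (map_zero _)
    rw [h2, h3, hd ℓ e₀ (mem_chart_source BM b₀)] at h1
    linarith
  have h0 : chartD b₀ b₀ (mfderiv 𝓘(ℝ, EM) 𝓘(ℝ, BM) π e₀
      (VectorField.mlieBracket 𝓘(ℝ, EM) Y W e₀)) = 0 := by
    by_contra hne
    obtain ⟨ℓ, hℓ⟩ := SeparatingDual.exists_ne_zero (R := ℝ) hne
    exact hℓ (key ℓ)
  rw [mem_vert, ← chartDinv_chartD (mem_chart_source BM b₀) (mfderiv 𝓘(ℝ, EM) 𝓘(ℝ, BM) π e₀ _), h0,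
    map_zero]

/-- The exterior derivative of a form that vanishes on vertical vectors vanishes on pairs of
vertical vectors. -/
theorem dForm_apply_eq_zero_of_ann {π : E → B} (hπ : ContMDiff 𝓘(ℝ, EM) 𝓘(ℝ, BM) ∞ π)
    {β : Π e : E, Cot EM e} {U W : Π e : E, Tan EM e} {e₀ : E}
    (hβ : SmoothFormAt β e₀) (hU : SmoothVFAt U e₀) (hW : SmoothVFAt W e₀)
    (hβa : ∀ e, β e ∈ ann (vert EM BM π e))
    (hUv : ∀ e, U e ∈ vert EM BM π e) (hWv : ∀ e, W e ∈ vert EM BM π e) :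
    dForm β e₀ (U e₀) (W e₀) = 0 := by
  have hbr := mlieBracket_mem_vert hπ (SmoothVFAt.zero (π e₀)) hU hW (fun e => hUv e) hWv
  have h0 : ∀ V : Π e : E, Tan EM e, (∀ e, V e ∈ vert EM BM π e) → ∀ v : Tan EM e₀,
      dFun (fun e => β e (V e)) e₀ v = 0 := by
    intro V hV v
    have : (fun e => β e (V e)) = fun _ => (0 : ℝ) := funext fun e => hβa e _ (hV e)
    unfold dFun
    rw [this, mfderiv_const]
    rfl
  rw [dForm_apply_vectorField hβ hU hW, h0 W hWv, h0 U hUv, hβa e₀ _ hbr]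
  simp

end Vertical

/-! ### Maximal isotropic subspaces and linear equations with parameters -/

section Duality

variable {T : Type*} [NormedAddCommGroup T] [NormedSpace ℝ T]

/-- A finite-dimensional `T ⊕ T*` is its own dual. -/
theorem exists_functional_eq [FiniteDimensional ℝ T] (f : (T × (T →L[ℝ] ℝ)) →ₗ[ℝ] ℝ) :
    ∃ (u : T) (ξ : T →L[ℝ] ℝ), ∀ p, f p = ξ p.1 + p.2 u := by
  let g : Module.Dual ℝ (Module.Dual ℝ T) :=
    (f ∘ₗ LinearMap.inr ℝ T (T →L[ℝ] ℝ)) ∘ₗ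
      (LinearMap.toContinuousLinearMap (𝕜 := ℝ) (E := T) (F' := ℝ)).toLinearMap
  refine ⟨(Module.evalEquiv ℝ T).symm g,
    LinearMap.toContinuousLinearMap (f ∘ₗ LinearMap.inl ℝ T (T →L[ℝ] ℝ)), fun p => ?_⟩
  have h : p.2 ((Module.evalEquiv ℝ T).symm g) = f (0, p.2) := by
    have h1 : Module.evalEquiv ℝ T ((Module.evalEquiv ℝ T).symm g) p.2.toLinearMap =
        g p.2.toLinearMap := by
      rw [LinearEquiv.apply_symm_apply]
    exact h1
  rw [h]
  have : p = (p.1, 0) + (0, p.2) := by simp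
  conv_lhs => rw [this, map_add]
  rfl

theorem exists_functional_ne_zero [FiniteDimensional ℝ T] {V : Submodule ℝ T} {u : T} (hu : u ∉ V) :
    ∃ α : T →L[ℝ] ℝ, (∀ v ∈ V, α v = 0) ∧ α u ≠ 0 := by
  obtain ⟨f, hf, hV⟩ := Submodule.exists_le_ker_of_notMem hu
  exact ⟨LinearMap.toContinuousLinearMap f, fun v hv => hV hv, hf⟩

theorem exists_functional_comp_eq {T' : Type*} [NormedAddCommGroup T'] [NormedSpace ℝ T']
    [FiniteDimensional ℝ T'] (D : T →L[ℝ] T') (α : T →L[ℝ] ℝ) (h : ∀ v, D v = 0 → α v = 0) :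
    ∃ μ : T' →L[ℝ] ℝ, μ.comp D = α := by
  have h1 : α.toLinearMap ∈ LinearMap.range D.toLinearMap.dualMap := by
    rw [LinearMap.range_dualMap_eq_dualAnnihilator_ker, Submodule.mem_dualAnnihilator]
    exact fun v hv => h v hv
  obtain ⟨μ, hμ⟩ := h1
  refine ⟨LinearMap.toContinuousLinearMap μ, ?_⟩
  ext v
  exact LinearMap.congr_fun hμ v

end Duality

section Isotropic

variable {EM : Type*} [NormedAddCommGroup EM] [NormedSpace ℝ EM]
variable {M : Type*} [TopologicalSpace M] [ChartedSpace EM M]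

/-- A maximal isotropic subspace contains every isotropic vector that is orthogonal to it. -/
theorem mem_of_maximal_isIsotropic {x : M} {S : Submodule ℝ (Tan EM x × Cot EM x)}
    (hS : Maximal IsIsotropic S) {q : Tan EM x × Cot EM x} (hq : pairing q q = 0)
    (hqS : ∀ p ∈ S, pairing q p = 0) : q ∈ S := by
  have hiso : IsIsotropic (S ⊔ Submodule.span ℝ {q}) := by
    intro p hp p' hp'
    obtain ⟨a, ha, b, hb, rfl⟩ := Submodule.mem_sup.1 hp
    obtain ⟨a', ha', b', hb', rfl⟩ := Submodule.mem_sup.1 hp'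
    obtain ⟨c, rfl⟩ := Submodule.mem_span_singleton.1 hb
    obtain ⟨c', rfl⟩ := Submodule.mem_span_singleton.1 hb'
    have h1 := hS.prop a ha a' ha'
    have h2 := hqS a ha
    have h3 := hqS a' ha'
    simp only [pairing, Prod.fst_add, Prod.snd_add, Prod.smul_fst, Prod.smul_snd, map_add,
      map_smul, add_apply, smul_apply, smul_eq_mul] at *
    linear_combination h1 + c' * h2 + c * h3 + c * c' * hq
  exact (hS.le_of_ge hiso le_sup_left)
    (Submodule.mem_sup_right (Submodule.mem_span_singleton_self q))

/-- A maximal isotropic subspace `S` that is transverse to the Lagrangian subspace `V ⊕ Ann V` is a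
complement of it: a vector orthogonal to both summands lies in `V ⊕ Ann V`, so it is isotropic, so
it lies in `S` as well by maximality. -/
theorem exists_mem_sub_mem [FiniteDimensional ℝ EM] {x : M}
    {S : Submodule ℝ (Tan EM x × Cot EM x)} (hS : Maximal IsIsotropic S)
    {V : Submodule ℝ (Tan EM x)} (hV : S ⊓ V.prod (ann V) = ⊥) (p : Tan EM x × Cot EM x) :
    ∃ q ∈ S, q.1 - p.1 ∈ V ∧ q.2 - p.2 ∈ ann V := by
  have htop : S ⊔ V.prod (ann V) = ⊤ := by
    by_contra hne
    obtain ⟨f, hf, hle⟩ := Submodule.exists_le_ker_of_lt_top _ (lt_top_iff_ne_top.2 hne)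
    obtain ⟨u, ξ, hfu⟩ : ∃ (u : Tan EM x) (ξ : Cot EM x), ∀ p, f p = ξ p.1 + p.2 u :=
      exists_functional_eq (T := EM) f
    have hS0 : ∀ p ∈ S, f p = 0 := fun p hp => hle (Submodule.mem_sup_left hp)
    have hC0 : ∀ v ∈ V, ∀ β ∈ ann V, f (v, β) = 0 := fun v hv β hβ =>
      hle (Submodule.mem_sup_right ⟨hv, hβ⟩)
    have hu : u ∈ V := by
      by_contra hu
      obtain ⟨α, hα, hαu⟩ : ∃ α : Cot EM x, (∀ v ∈ V, α v = 0) ∧ α u ≠ 0 :=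
        exists_functional_ne_zero (T := EM) (V := V) hu
      have := hC0 0 V.zero_mem α hα
      rw [hfu] at this
      exact hαu (by simpa using this)
    have hξ : ξ ∈ ann V := fun v hv => by
      have := hC0 v hv 0 (ann V).zero_mem
      rw [hfu] at this
      simpa using this
    have hq : (u, ξ) ∈ S := by
      refine mem_of_maximal_isIsotropic hS ?_ fun p hp => ?_
      · simp [pairing, hξ u hu]
      · have := hS0 p hp
        rw [hfu] at this
        simp [pairing, this]
    have h0 : (u, ξ) ∈ S ⊓ V.prod (ann V) := ⟨hq, hu, hξ⟩
    rw [hV, Submodule.mem_bot, Prod.mk_eq_zero] at h0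
    refine hf (LinearMap.ext fun p => ?_)
    rw [hfu, h0.1, h0.2]
    simp
  have hp : p ∈ S ⊔ V.prod (ann V) := htop ▸ Submodule.mem_top
  obtain ⟨q, hq, c, hc, rfl⟩ := Submodule.mem_sup.1 hp
  refine ⟨q, hq, ?_, ?_⟩
  · simpa using V.neg_mem hc.1
  · simpa using (ann V).neg_mem hc.2

end Isotropic

section Smoothness

variable {EM : Type*} [NormedAddCommGroup EM] [NormedSpace ℝ EM]
variable {M : Type*} [TopologicalSpace M] [ChartedSpace EM M]

/-- The solutions of a smooth family of injective linear equations depend smoothly on the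
parameter. -/
theorem contMDiffAt_of_injective {V W : Type*} [NormedAddCommGroup V] [NormedSpace ℝ V]
    [FiniteDimensional ℝ V] [NormedAddCommGroup W] [NormedSpace ℝ W] [FiniteDimensional ℝ W]
    {A : M → V →L[ℝ] W} {t : M → W} {c : M → V} {x₀ : M}
    (hA : ContMDiffAt 𝓘(ℝ, EM) 𝓘(ℝ, V →L[ℝ] W) ∞ A x₀)
    (ht : ContMDiffAt 𝓘(ℝ, EM) 𝓘(ℝ, W) ∞ t x₀)
    (hinj : ∀ v, A x₀ v = 0 → v = 0) (hc : ∀ᶠ x in 𝓝 x₀, A x (c x) = t x) :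
    ContMDiffAt 𝓘(ℝ, EM) 𝓘(ℝ, V) ∞ c x₀ := by
  have : CompleteSpace V := FiniteDimensional.complete ℝ V
  obtain ⟨R, hR⟩ := LinearMap.exists_leftInverse_of_injective (A x₀).toLinearMap
    (LinearMap.ker_eq_bot'.2 hinj)
  let R' : W →L[ℝ] V := LinearMap.toContinuousLinearMap R
  have hN : ContMDiffAt 𝓘(ℝ, EM) 𝓘(ℝ, V →L[ℝ] V) ∞ (fun x => R'.comp (A x)) x₀ :=
    contMDiffAt_const.clm_comp hA
  -- with `R'` a left inverse of `A x₀`, the solution is `c = (R' A)⁻¹ R' t` near `x₀`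
  have hN0 : R'.comp (A x₀) = (ContinuousLinearEquiv.refl ℝ V : V →L[ℝ] V) := by
    ext v
    exact LinearMap.congr_fun hR v
  have hinv : ContMDiffAt 𝓘(ℝ, EM) 𝓘(ℝ, V →L[ℝ] V) ∞
      (fun x => ContinuousLinearMap.inverse (R'.comp (A x))) x₀ := by
    have h1 : ContDiffAt ℝ ∞ ContinuousLinearMap.inverse (R'.comp (A x₀)) := by
      rw [hN0]
      exact contDiffAt_map_inverse _
    exact h1.contMDiffAt.comp x₀ hN
  refine (hinv.clm_apply (contMDiffAt_const (c := R').clm_apply ht)).congr_of_eventuallyEq ?_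
  have hev : ∀ᶠ x in 𝓝 x₀, R'.comp (A x) ∈ Set.range ((↑) : (V ≃L[ℝ] V) → V →L[ℝ] V) := by
    refine hN.continuousAt.eventually ?_
    change ∀ᶠ y in 𝓝 (R'.comp (A x₀)), _
    rw [hN0]
    exact ContinuousLinearEquiv.nhds _
  filter_upwards [hev, hc] with x hx hcx
  obtain ⟨e, he⟩ := hx
  rw [← hcx, ← he, ContinuousLinearMap.inverse_equiv]
  have : R' (A x (c x)) = e (c x) := congrArg (fun f => f (c x)) he.symm
  rw [this]
  simp

end Smoothness

/-! ### Smoothness of sections of a Dirac structure -/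

section SmoothLift

variable {EM : Type*} [NormedAddCommGroup EM] [NormedSpace ℝ EM]
  {BM : Type*} [NormedAddCommGroup BM] [NormedSpace ℝ BM]
  {E : Type*} [TopologicalSpace E] [ChartedSpace EM E]
  {B : Type*} [TopologicalSpace B] [ChartedSpace BM B]

variable (EM BM) in
/-- The differential of `π` at `e`, read in the charts at `e₀` and at `π e₀`. -/
def projD (π : E → B) (e₀ e : E) : EM →L[ℝ] BM :=
  (chartD (π e₀) (π e)).comp ((mfderiv 𝓘(ℝ, EM) 𝓘(ℝ, BM) π e).comp (chartDinv e₀ e))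

/-- The linear map `(c, μ) ↦ (D (∑ cᵢ xᵢ), ∑ cᵢ ξᵢ - μ ∘ D)`. When `(xᵢ, ξᵢ)` is a frame of `L` and
`D` is the differential of the projection, all read in charts, the forms `μ ∘ D` are those that
vanish on vertical vectors; so solving for `(c, μ)` finds the element of `L` with a prescribed class
in `TE / Vert` and a prescribed restriction to `Vert`. -/
def frameMap {k : ℕ} (x : Fin k → EM) (ξ : Fin k → EM →L[ℝ] ℝ) (D : EM →L[ℝ] BM) :
    (Fin k → ℝ) × (BM →L[ℝ] ℝ) →L[ℝ] BM × (EM →L[ℝ] ℝ) :=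
  (∑ i, ContinuousLinearMap.smulRightL ℝ _ _
      ((ContinuousLinearMap.proj i).comp (ContinuousLinearMap.fst ℝ (Fin k → ℝ) (BM →L[ℝ] ℝ)))
      (D (x i), ξ i)) -
    (ContinuousLinearMap.inr ℝ BM (EM →L[ℝ] ℝ)).comp
      (((ContinuousLinearMap.compL ℝ EM BM ℝ).flip D).comp
        (ContinuousLinearMap.snd ℝ (Fin k → ℝ) (BM →L[ℝ] ℝ)))

theorem frameMap_apply {k : ℕ} (x : Fin k → EM) (ξ : Fin k → EM →L[ℝ] ℝ) (D : EM →L[ℝ] BM)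
    (c : Fin k → ℝ) (μ : BM →L[ℝ] ℝ) :
    frameMap x ξ D (c, μ) = (D (∑ i, c i • x i), ∑ i, c i • ξ i - μ.comp D) := by
  simp [frameMap, Prod.ext_iff, Prod.fst_sum, Prod.snd_sum]

theorem contMDiffAt_frameMap {k : ℕ} {x : E → Fin k → EM} {ξ : E → Fin k → EM →L[ℝ] ℝ}
    {D : E → EM →L[ℝ] BM} {e₀ : E}
    (hx : ∀ i, ContMDiffAt 𝓘(ℝ, EM) 𝓘(ℝ, EM) ∞ (fun e => x e i) e₀)
    (hξ : ∀ i, ContMDiffAt 𝓘(ℝ, EM) 𝓘(ℝ, EM →L[ℝ] ℝ) ∞ (fun e => ξ e i) e₀)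
    (hD : ContMDiffAt 𝓘(ℝ, EM) 𝓘(ℝ, EM →L[ℝ] BM) ∞ D e₀) :
    ContMDiffAt 𝓘(ℝ, EM) 𝓘(ℝ, (Fin k → ℝ) × (BM →L[ℝ] ℝ) →L[ℝ] BM × (EM →L[ℝ] ℝ)) ∞
      (fun e => frameMap (x e) (ξ e) (D e)) e₀ := by
  unfold frameMap
  refine ContMDiffAt.sub (ContMDiffAt.sum (t := Finset.univ)
    (f := fun i e => ContinuousLinearMap.smulRightL ℝ _ _ ((ContinuousLinearMap.proj i).comp
      (ContinuousLinearMap.fst ℝ (Fin k → ℝ) (BM →L[ℝ] ℝ))) (D e (x e i), ξ e i))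
    fun i _ => ?_) ?_
  · exact contMDiffAt_const.clm_apply ((hD.clm_apply (hx i)).prodMk_space (hξ i))
  · exact contMDiffAt_const.clm_comp ((contMDiffAt_const.clm_apply hD).clm_comp contMDiffAt_const)

variable [IsManifold 𝓘(ℝ, EM) ∞ E]

theorem projD_chartD {π : E → B} {e₀ e : E} (he : e ∈ (chartAt EM e₀).source) (v : Tan EM e) :
    projD EM BM π e₀ (e := e) (chartD e₀ e v) =
      chartD (π e₀) (π e) (mfderiv 𝓘(ℝ, EM) 𝓘(ℝ, BM) π e v) := by
  have := chartDinv_chartD he v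
  exact congrArg (fun w => chartD (π e₀) (π e) (mfderiv 𝓘(ℝ, EM) 𝓘(ℝ, BM) π e w)) this

theorem chartD_eq_zero_iff {x₀ x : E} (hx : x ∈ (chartAt EM x₀).source) {v : Tan EM x} :
    chartD x₀ x v = 0 ↔ v = 0 := by
  refine ⟨fun h => ?_, fun h => by rw [h, map_zero]⟩
  rw [← chartDinv_chartD hx v, h, map_zero]

variable [IsManifold 𝓘(ℝ, BM) ∞ B]

theorem contMDiffAt_projD {π : E → B} (hπ : ContMDiff 𝓘(ℝ, EM) 𝓘(ℝ, BM) ∞ π) (e₀ : E) :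
    ContMDiffAt 𝓘(ℝ, EM) 𝓘(ℝ, EM →L[ℝ] BM) ∞ (projD EM BM π e₀) e₀ := by
  have : IsManifold 𝓘(ℝ, EM) 1 E := .of_le (n := ∞) (by simp)
  have : IsManifold 𝓘(ℝ, BM) 1 B := .of_le (n := ∞) (by simp)
  have h := (hπ e₀).mfderiv_const (m := ∞) (by simp)
  refine h.congr_of_eventuallyEq ?_
  filter_upwards [chart_source_mem_nhds EM e₀,
    (hπ e₀).continuousAt.eventually (chart_source_mem_nhds BM (π e₀))] with e he he'
  rw [inTangentCoordinates_eq_mfderiv_comp (I := 𝓘(ℝ, EM)) (I' := 𝓘(ℝ, BM)) he he']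
  simp only [modelWithCornersSelf_coe, Set.range_id, mfderivWithin_univ]
  rfl

/-- A section `(Y, η)` of `L` is smooth as soon as its class in `TE / Vert ⊕ Vert*` is: its
coefficients in a smooth frame of `L` solve the linear system `frameMap`, which is injective because
`L` is transverse to `Vert ⊕ Ann Vert`. -/
theorem smooth_of_smooth_class [FiniteDimensional ℝ EM] [FiniteDimensional ℝ BM] {π : E → B}
    (hπ : ContMDiff 𝓘(ℝ, EM) 𝓘(ℝ, BM) ∞ π) {L : Π e : E, Submodule ℝ (Tan EM e × Cot EM e)}
    (hL : IsSmoothSubbundle L) {e₀ : E}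
    (htr : L e₀ ⊓ (vert EM BM π e₀).prod (ann (vert EM BM π e₀)) = ⊥)
    (hsurj : Function.Surjective (mfderiv 𝓘(ℝ, EM) 𝓘(ℝ, BM) π e₀))
    {Y : Π e : E, Tan EM e} {η α : Π e : E, Cot EM e} {X : Π b : B, Tan BM b}
    (hY : ∀ e, (Y e, η e) ∈ L e)
    (hYX : ∀ e, mfderiv 𝓘(ℝ, EM) 𝓘(ℝ, BM) π e (Y e) = X (π e))
    (hηα : ∀ e, η e - α e ∈ ann (vert EM BM π e))
    (hX : SmoothVFAt X (π e₀)) (hα : SmoothFormAt α e₀) :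
    SmoothVFAt Y e₀ ∧ SmoothFormAt η e₀ := by
  obtain ⟨U, hU, k, V, ξ, hs, hfr⟩ := hL e₀
  have hV : ∀ i, SmoothVFAt (V i) e₀ := fun i => (hs i).1.smoothVFAt hU
  have hξ : ∀ i, SmoothFormAt (ξ i) e₀ := fun i => (hs i).2.smoothFormAt hU
  have he₀ := mem_chart_source EM e₀
  have hb₀ := mem_chart_source BM (π e₀)
  let x : E → Fin k → EM := fun e i => chartD e₀ e (V i e)
  let z : E → Fin k → EM →L[ℝ] ℝ := fun e i => (ξ i e).comp (chartDinv e₀ e)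
  have hA := contMDiffAt_frameMap (x := x) (ξ := z) (fun i => smoothVFAt_iff.1 (hV i))
    (fun i => smoothFormAt_iff.1 (hξ i)) (contMDiffAt_projD hπ e₀)
  have ht : ContMDiffAt 𝓘(ℝ, EM) 𝓘(ℝ, BM × (EM →L[ℝ] ℝ)) ∞
      (fun e => (chartD (π e₀) (π e) (X (π e)), (α e).comp (chartDinv e₀ e))) e₀ :=
    ((smoothVFAt_iff.1 hX).comp e₀ (hπ e₀)).prodMk_space (smoothFormAt_iff.1 hα)
  have hsum : ∀ (e : E) (c : Fin k → ℝ),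
      (∑ i, c i • V i e, ∑ i, c i • ξ i e) = ∑ i, c i • (V i e, ξ i e) := fun e c => by
    simp [Prod.ext_iff, Prod.fst_sum, Prod.snd_sum]
  -- injectivity of the linear system at `e₀`
  have hinj : ∀ v, frameMap (x e₀) (z e₀) (projD EM BM π e₀ e₀) v = 0 → v = 0 := by
    rintro ⟨c, μ⟩ h
    rw [frameMap_apply, Prod.mk_eq_zero] at h
    have hu : (∑ i, c i • x e₀ i) = chartD e₀ e₀ (∑ i, c i • V i e₀) := by
      simp [x, map_sum]
    have hmem : (∑ i, c i • V i e₀, ∑ i, c i • ξ i e₀) ∈ L e₀ := by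
      rw [hsum, ← (hfr e₀ (mem_of_mem_nhds hU)).2]
      exact Submodule.sum_mem _ fun i _ =>
        Submodule.smul_mem _ _ (Submodule.subset_span (Set.mem_range_self i))
    have hu0 : ∑ i, c i • V i e₀ ∈ vert EM BM π e₀ := by
      rw [mem_vert, ← chartD_eq_zero_iff hb₀, ← projD_chartD he₀, ← hu]
      exact h.1
    have hv : (∑ i, c i • z e₀ i) = (∑ i, c i • ξ i e₀).comp (chartDinv e₀ e₀) := by
      ext w
      simp [z]
    have hv0 : ∑ i, c i • ξ i e₀ ∈ ann (vert EM BM π e₀) := by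
      intro w hw
      have h1 := congrArg (fun f => f (chartD e₀ e₀ w)) (sub_eq_zero.1 (hv ▸ h.2))
      have h2 : (∑ i, c i • ξ i e₀) (chartDinv e₀ e₀ (chartD e₀ e₀ w)) =
          μ (projD EM BM π e₀ e₀ (chartD e₀ e₀ w)) := h1
      rw [chartDinv_chartD he₀, projD_chartD he₀, mem_vert.1 hw, map_zero, map_zero] at h2
      exact h2
    have h0 : (∑ i, c i • V i e₀, ∑ i, c i • ξ i e₀) = (0 : Tan EM e₀ × Cot EM e₀) := by
      rw [← Submodule.mem_bot ℝ, ← htr]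
      exact ⟨hmem, hu0, hv0⟩
    have hc0 : c = 0 :=
      funext (Fintype.linearIndependent_iff.1 (hfr e₀ (mem_of_mem_nhds hU)).1 c (hsum e₀ c ▸ h0))
    have hμ0 : μ = 0 := by
      have h1 := h.2
      rw [hc0] at h1
      simp only [Pi.zero_apply, zero_smul, Finset.sum_const_zero, zero_sub, neg_eq_zero] at h1
      ext b
      obtain ⟨w, hw⟩ := hsurj (chartDinv (π e₀) (π e₀) b)
      have h2 := congrArg (fun f => f (chartD e₀ e₀ w)) h1
      have h3 : μ (projD EM BM π e₀ e₀ (chartD e₀ e₀ w)) = 0 := h2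
      rw [projD_chartD he₀, hw, chartD_chartDinv hb₀] at h3
      exact h3
    rw [hc0, hμ0]
    rfl
  have hsol : ∀ e, ∃ p : (Fin k → ℝ) × (BM →L[ℝ] ℝ),
      e ∈ U → e ∈ (chartAt EM e₀).source → π e ∈ (chartAt BM (π e₀)).source →
      Y e = ∑ i, p.1 i • V i e ∧ η e = ∑ i, p.1 i • ξ i e ∧
      frameMap (x e) (z e) (projD EM BM π e₀ e) p =
        (chartD (π e₀) (π e) (X (π e)), (α e).comp (chartDinv e₀ e)) := by
    intro e
    by_cases he : e ∈ U ∧ e ∈ (chartAt EM e₀).source ∧ π e ∈ (chartAt BM (π e₀)).source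
    swap
    · exact ⟨0, fun h1 h2 h3 => (he ⟨h1, h2, h3⟩).elim⟩
    have h1 := hY e
    rw [← (hfr e he.1).2] at h1
    obtain ⟨c, hc⟩ := (Submodule.mem_span_range_iff_exists_fun ℝ).1 h1
    rw [← hsum, Prod.mk.injEq] at hc
    obtain ⟨μ, hμ⟩ := exists_functional_comp_eq (projD EM BM π e₀ e)
      ((η e - α e).comp (chartDinv e₀ e)) (by
        intro v hv
        refine hηα e _ ?_
        rw [mem_vert, ← chartD_eq_zero_iff he.2.2]
        exact hv)
    refine ⟨(c, μ), fun _ _ _ => ⟨hc.1.symm, hc.2.symm, ?_⟩⟩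
    rw [frameMap_apply, hμ]
    have hu : (∑ i, c i • x e i) = chartD e₀ e (Y e) := by
      rw [← hc.1]
      simp [x, map_sum]
    have hv : (∑ i, c i • z e i) = (η e).comp (chartDinv e₀ e) := by
      rw [← hc.2]
      ext w
      simp [z]
    rw [hu, projD_chartD he.2.1, hYX, hv]
    congr 1
    ext w
    simp
  choose p hp using hsol
  have hev : ∀ᶠ e in 𝓝 e₀, Y e = ∑ i, (p e).1 i • V i e ∧ η e = ∑ i, (p e).1 i • ξ i e ∧
      frameMap (x e) (z e) (projD EM BM π e₀ e) (p e) =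
        (chartD (π e₀) (π e) (X (π e)), (α e).comp (chartDinv e₀ e)) := by
    filter_upwards [hU, chart_source_mem_nhds EM e₀,
      (hπ e₀).continuousAt.eventually (chart_source_mem_nhds BM (π e₀))] with e h1 h2 h3
    exact hp e h1 h2 h3
  have hpsm := contMDiffAt_of_injective hA ht hinj (hev.mono fun e h => h.2.2)
  have hc : ∀ i, ContMDiffAt 𝓘(ℝ, EM) 𝓘(ℝ, ℝ) ∞ (fun e => (p e).1 i) e₀ := fun i =>
    contMDiffAt_const (c := ((ContinuousLinearMap.proj i).comp
      (ContinuousLinearMap.fst ℝ (Fin k → ℝ) (BM →L[ℝ] ℝ)))).clm_apply hpsm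
  refine ⟨smoothVFAt_iff.2 ?_, smoothFormAt_iff.2 ?_⟩
  · refine (ContMDiffAt.sum (t := Finset.univ) (f := fun i e => (p e).1 i • x e i)
      fun i _ => (hc i).smul (smoothVFAt_iff.1 (hV i))).congr_of_eventuallyEq ?_
    filter_upwards [hev] with e he
    simp [he.1, x, map_sum]
  · refine (ContMDiffAt.sum (t := Finset.univ) (f := fun i e => (p e).1 i • z e i)
      fun i _ => (hc i).smul (smoothFormAt_iff.1 (hξ i))).congr_of_eventuallyEq ?_
    filter_upwards [hev] with e he
    ext v
    simp [he.2.1, z]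

end SmoothLift

/-! ### The horizontal lifts and the vertical bivector field -/

section Bundle

variable {EM : Type*} [NormedAddCommGroup EM] [NormedSpace ℝ EM]
  {BM : Type*} [NormedAddCommGroup BM] [NormedSpace ℝ BM]
  {FM : Type*} [NormedAddCommGroup FM] [NormedSpace ℝ FM]
  {E : Type*} [TopologicalSpace E] [ChartedSpace EM E]
  {B : Type*} [TopologicalSpace B] [ChartedSpace BM B]
  {F : Type*} [TopologicalSpace F] [ChartedSpace FM F] [IsManifold 𝓘(ℝ, FM) ∞ F]
  {π : E → B} {P : PoissonStructure FM F}

namespace PoissonFiberBundle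

variable (Q : PoissonFiberBundle EM BM π P)

theorem mdifferentiableAt_symm {φ : Bundle.Trivialization F π} (hφ : φ ∈ Q.atlas) {b : B}
    (hb : b ∈ φ.baseSet) (y : F) :
    MDifferentiableAt (𝓘(ℝ, BM).prod 𝓘(ℝ, FM)) 𝓘(ℝ, EM) φ.toOpenPartialHomeomorph.symm (b, y) :=
  ((Q.smooth_symm φ hφ).contMDiffAt
    (φ.open_target.mem_nhds (φ.mem_target.2 hb))).mdifferentiableAt (by simp)

theorem mfderiv_fiberMap {φ : Bundle.Trivialization F π} (hφ : φ ∈ Q.atlas) {b : B}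
    (hb : b ∈ φ.baseSet) (y : F) (w : Tan FM y) :
    mfderiv 𝓘(ℝ, FM) 𝓘(ℝ, EM) (fiberMap φ b) y w =
      mfderiv (𝓘(ℝ, BM).prod 𝓘(ℝ, FM)) 𝓘(ℝ, EM) φ.toOpenPartialHomeomorph.symm (b, y)
        ((0 : BM), w) := by
  have h1 := (hasMFDerivAt_const (I := 𝓘(ℝ, FM)) (I' := 𝓘(ℝ, BM)) b y).prodMk
    (hasMFDerivAt_id (I := 𝓘(ℝ, FM)) y)
  have h2 := (Q.mdifferentiableAt_symm hφ hb y).hasMFDerivAt.comp y h1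
  exact congrArg (fun f => f w) h2.mfderiv

theorem proj_fiberMap {φ : Bundle.Trivialization F π} {b : B} (hb : b ∈ φ.baseSet) (y : F) :
    π (fiberMap φ b y) = b :=
  φ.proj_symm_apply' hb

theorem fiberMap_snd {φ : Bundle.Trivialization F π} {e : E} (he : π e ∈ φ.baseSet) :
    fiberMap φ (π e) (φ e).2 = e :=
  φ.symm_apply_mk_proj (φ.mem_source.2 he)

theorem mfderiv_proj_surjective (Q : PoissonFiberBundle EM BM π P) (e : E) :
    Function.Surjective (mfderiv 𝓘(ℝ, EM) 𝓘(ℝ, BM) π e) := by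
  obtain ⟨φ, hφ, hb⟩ := Q.cover (π e)
  intro v
  have he : φ.toOpenPartialHomeomorph.symm (π e, (φ e).2) = e := fiberMap_snd hb
  have h1 := (hasMFDerivAt_id (I := 𝓘(ℝ, BM)) (π e)).prodMk
    (hasMFDerivAt_const (I := 𝓘(ℝ, BM)) (I' := 𝓘(ℝ, FM)) (φ e).2 (π e))
  have h2 := (Q.mdifferentiableAt_symm hφ hb (φ e).2).hasMFDerivAt.comp (π e) h1
  have h3 : MDifferentiableAt 𝓘(ℝ, EM) 𝓘(ℝ, BM) π
      (φ.toOpenPartialHomeomorph.symm (π e, (φ e).2)) :=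
    (Q.smooth_proj _).mdifferentiableAt (by simp)
  have h4 := h3.hasMFDerivAt.comp (π e) h2
  have h5 : (π ∘ φ.toOpenPartialHomeomorph.symm ∘ fun b => (id b, (φ e).2)) =ᶠ[𝓝 (π e)] id := by
    filter_upwards [φ.open_baseSet.mem_nhds hb] with b hb'
    exact proj_fiberMap hb' _
  have h6 := (h4.congr_of_eventuallyEq h5.symm).mfderiv
  rw [mfderiv_id, he] at h6
  exact ⟨_, (congrArg (fun f => f v) h6).symm⟩

/-- The tangent spaces of the fibers are the vertical spaces. -/
theorem mem_vert_iff {φ : Bundle.Trivialization F π} (hφ : φ ∈ Q.atlas) {e : E}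
    (he : π e ∈ φ.baseSet) (u : EM) :
    u ∈ (vert EM BM π e : Submodule ℝ EM) ↔
      ∃ w : FM, (mfderiv 𝓘(ℝ, FM) 𝓘(ℝ, EM) (fiberMap φ (π e)) (φ e).2 : FM →L[ℝ] EM) w = u := by
  have hi := fiberMap_snd he
  constructor
  · intro hu
    have hu' : mfderiv 𝓘(ℝ, EM) 𝓘(ℝ, BM) π e u = 0 := hu
    have hφe : MDifferentiableAt 𝓘(ℝ, EM) (𝓘(ℝ, BM).prod 𝓘(ℝ, FM)) φ e :=
      ((Q.smooth φ hφ).contMDiffAt (φ.open_source.mem_nhds (φ.mem_source.2 he))).mdifferentiableAt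
        (by simp)
    have h1 := ((Q.smooth_proj e).mdifferentiableAt (by simp)).hasMFDerivAt.prodMk
      hφe.snd.hasMFDerivAt
    have h2 := (Q.mdifferentiableAt_symm hφ he (φ e).2).hasMFDerivAt.comp e h1
    have h5 : (φ.toOpenPartialHomeomorph.symm ∘ fun e => (π e, (φ e).2)) =ᶠ[𝓝 e] id := by
      filter_upwards [(Q.smooth_proj e).continuousAt.eventually (φ.open_baseSet.mem_nhds he)]
        with e' he'
      exact fiberMap_snd he'
    have h6 := (h2.congr_of_eventuallyEq h5.symm).mfderiv
    rw [mfderiv_id] at h6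
    have h7 := (congrArg (fun f => f u) h6).symm
    refine ⟨mfderiv 𝓘(ℝ, EM) 𝓘(ℝ, FM) (fun e => (φ e).2) e u, ?_⟩
    refine (Q.mfderiv_fiberMap hφ he (φ e).2 _).trans (Eq.trans ?_ h7)
    refine congrArg (mfderiv (𝓘(ℝ, BM).prod 𝓘(ℝ, FM)) 𝓘(ℝ, EM)
      φ.toOpenPartialHomeomorph.symm (π e, (φ e).2)) ?_
    exact Prod.ext hu'.symm rfl
  · rintro ⟨w, rfl⟩
    have h1 : MDifferentiableAt 𝓘(ℝ, FM) 𝓘(ℝ, EM) (fiberMap φ (π e)) (φ e).2 :=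
      (Q.mdifferentiableAt_symm hφ he (φ e).2).comp (φ e).2
        (mdifferentiableAt_const.prodMk mdifferentiableAt_id)
    have h2 : MDifferentiableAt 𝓘(ℝ, EM) 𝓘(ℝ, BM) π (fiberMap φ (π e) (φ e).2) :=
      (Q.smooth_proj _).mdifferentiableAt (by simp)
    have h3 := (h2.hasMFDerivAt.comp _ h1.hasMFDerivAt).mfderiv
    have h4 : π ∘ fiberMap φ (π e) = fun _ => π e := funext fun y => proj_fiberMap he y
    rw [h4, mfderiv_const, hi] at h3
    exact (congrArg (fun f => f w) h3).symm

variable {Q} {L : Π e : E, Submodule ℝ (Tan EM e × Cot EM e)}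

/-- The vertical bivector field only sees the restriction of a covector to the vertical space. -/
theorem vertSharp_congr {e : E} {α α' : Cot EM e} (h : α - α' ∈ ann (vert EM BM π e)) :
    Q.vertSharp e α = Q.vertSharp e α' := by
  have hspec := Classical.choose_spec (Q.cover (π e))
  unfold vertSharp
  set φ := Classical.choose (Q.cover (π e))
  have : ∀ di : Tan FM (φ e).2 →L[ℝ] Tan EM e, (∀ w, di w ∈ vert EM BM π e) →
      α.comp di = α'.comp di := by
    intro di hdi
    ext w
    have := h _ (hdi w)
    exact sub_eq_zero.1 this
  have h2 := this (mfderiv 𝓘(ℝ, FM) 𝓘(ℝ, EM) (fiberMap φ (π e)) (φ e).2)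
    fun w => (Q.mem_vert_iff hspec.1 hspec.2 _).2 ⟨w, rfl⟩
  exact congrArg (fun a => mfderiv 𝓘(ℝ, FM) 𝓘(ℝ, EM) (fiberMap φ (π e)) (φ e).2
    (P.sharp (φ e).2 a)) h2

variable [IsManifold 𝓘(ℝ, EM) ∞ E]

/-- The vertical part of `L` is the graph of the vertical Poisson bivector field. -/
theorem IsCoherentDirac.vertSharp_eq (h : Q.IsCoherentDirac L) {e : E} {u : Tan EM e} {v : Cot EM e}
    (hu : u ∈ vert EM BM π e) (huv : (u, v) ∈ L e) : Q.vertSharp e v = u := by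
  have hspec := Classical.choose_spec (Q.cover (π e))
  set φ := Classical.choose (Q.cover (π e)) with hφ
  have hi := fiberMap_snd hspec.2
  obtain ⟨w, hw⟩ := (Q.mem_vert_iff hspec.1 hspec.2 u).1 hu
  -- transport along `fiberMap φ (π e) (φ e).2 = e`; all tangent spaces are the model space
  have htrans : ∀ e', e' = e → ((u, v) : EM × (EM →L[ℝ] ℝ)) ∈
      (L e' : Submodule ℝ (EM × (EM →L[ℝ] ℝ))) := by
    rintro _ rfl
    exact huv
  have hres := h.restricts φ hspec.1 (π e) hspec.2 (φ e).2
  have hmem := hres.le (show (w, v.comp _) ∈ _ from ⟨v, by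
    have := htrans _ hi
    rw [← hw] at this
    exact this, rfl⟩)
  have hw' : w = P.sharp (φ e).2 (v.comp _) := hmem
  unfold vertSharp
  rw [← hw]
  exact congrArg (mfderiv 𝓘(ℝ, FM) 𝓘(ℝ, EM) (fiberMap φ (π e)) (φ e).2) hw'.symm

variable [FiniteDimensional ℝ EM]

/-- `L` and `Vert ⊕ Ann Vert` are complementary. -/
theorem IsCoherentDirac.exists_mem (h : Q.IsCoherentDirac L) (e : E) (u : Tan EM e)
    (α : Cot EM e) : ∃ q ∈ L e, q.1 - u ∈ vert EM BM π e ∧ q.2 - α ∈ ann (vert EM BM π e) :=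
  exists_mem_sub_mem (h.dirac.maximal e) (h.transverse e) (u, α)

/-- For each `α`, the unique element of `L` that is vertical and restricts to `α|Vert` has the
vector part `𝒱 α`. -/
theorem IsCoherentDirac.vertSharp_mem (h : Q.IsCoherentDirac L) (e : E) (α : Cot EM e) :
    Q.vertSharp e α ∈ vert EM BM π e ∧
      ∃ v, (Q.vertSharp e α, v) ∈ L e ∧ v - α ∈ ann (vert EM BM π e) := by
  obtain ⟨⟨u, v⟩, hq, h1, h2⟩ := h.exists_mem e 0 α
  rw [sub_zero] at h1
  rw [← vertSharp_congr h2, h.vertSharp_eq h1 hq]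
  exact ⟨h1, v, hq, h2⟩

theorem IsCoherentDirac.vertSharp_skew (h : Q.IsCoherentDirac L) (e : E) (α β : Cot EM e) :
    β (Q.vertSharp e α) = - α (Q.vertSharp e β) := by
  obtain ⟨hu, v, hv, hvα⟩ := h.vertSharp_mem e α
  obtain ⟨hw, z, hz, hzβ⟩ := h.vertSharp_mem e β
  have h1 : v (Q.vertSharp e β) = α (Q.vertSharp e β) := sub_eq_zero.1 (hvα _ hw)
  have h2 : z (Q.vertSharp e α) = β (Q.vertSharp e α) := sub_eq_zero.1 (hzβ _ hu)
  have h3 := (h.dirac.maximal e).prop _ hv _ hz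
  simp only [pairing, h1, h2] at h3
  linarith

/-- Each vector field on the base has a horizontal lift `Y`, accompanied by a 1-form `β` that
vanishes on vertical vectors, such that `(Y, β)` is a section of `L`. -/
theorem IsCoherentDirac.exists_horizontal_section (h : Q.IsCoherentDirac L)
    (X : Π b : B, Tan BM b) : ∃ (Y : Π e : E, Tan EM e) (β : Π e : E, Cot EM e),
      (∀ e, (Y e, β e) ∈ L e) ∧ (∀ e, mfderiv 𝓘(ℝ, EM) 𝓘(ℝ, BM) π e (Y e) = X (π e)) ∧
      ∀ e, β e ∈ ann (vert EM BM π e) := by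
  have : ∀ e, ∃ q ∈ L e, mfderiv 𝓘(ℝ, EM) 𝓘(ℝ, BM) π e q.1 = X (π e) ∧
      q.2 ∈ ann (vert EM BM π e) := by
    intro e
    obtain ⟨u, hu⟩ := Q.mfderiv_proj_surjective e (X (π e))
    obtain ⟨q, hq, h1, h2⟩ := h.exists_mem e u 0
    rw [mem_vert, map_sub, sub_eq_zero, hu] at h1
    rw [sub_zero] at h2
    exact ⟨q, hq, h1, h2⟩
  choose q hq using this
  exact ⟨fun e => (q e).1, fun e => (q e).2, fun e => (hq e).1, fun e => (hq e).2.1,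
    fun e => (hq e).2.2⟩

theorem IsCoherentDirac.isCompl (h : Q.IsCoherentDirac L) (e : E) :
    IsCompl (horDist BM π L e) (vert EM BM π e) := by
  rw [isCompl_iff, Submodule.disjoint_def, codisjoint_iff, eq_top_iff]
  refine ⟨?_, fun u _ => ?_⟩
  · rintro u ⟨β, hβ, hu⟩ huv
    have h0 : (u, β) ∈ L e ⊓ (vert EM BM π e).prod (ann (vert EM BM π e)) := ⟨hu, huv, hβ⟩
    rw [h.transverse e, Submodule.mem_bot, Prod.mk_eq_zero] at h0
    exact h0.1
  · obtain ⟨q, hq, h1, h2⟩ := h.exists_mem e u 0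
    rw [sub_zero] at h2
    refine Submodule.mem_sup.2 ⟨q.1, ⟨q.2, h2, hq⟩, u - q.1, ?_, by simp⟩
    simpa using (vert EM BM π e).neg_mem h1

variable [IsManifold 𝓘(ℝ, BM) ∞ B] [FiniteDimensional ℝ BM]

theorem IsCoherentDirac.smooth_section (h : Q.IsCoherentDirac L) {e₀ : E}
    {Y : Π e : E, Tan EM e} {η α : Π e : E, Cot EM e} {X : Π b : B, Tan BM b}
    (hY : ∀ e, (Y e, η e) ∈ L e)
    (hYX : ∀ e, mfderiv 𝓘(ℝ, EM) 𝓘(ℝ, BM) π e (Y e) = X (π e))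
    (hηα : ∀ e, η e - α e ∈ ann (vert EM BM π e))
    (hX : SmoothVFAt X (π e₀)) (hα : SmoothFormAt α e₀) :
    SmoothVFAt Y e₀ ∧ SmoothFormAt η e₀ :=
  smooth_of_smooth_class Q.smooth_proj h.dirac.smooth (h.transverse e₀)
    (Q.mfderiv_proj_surjective e₀) hY hYX hηα hX hα

/-- Horizontal lifts preserve the vertical Poisson bivector field. The Courant bracket of
`(Y, β)` and `(𝒱 α, α')` lies in `L`, so by isotropy its pairing with `(𝒱 γ, γ')` vanishes. Twice
this pairing is `(L_Y 𝒱)(α, γ) - dβ(𝒱 α, 𝒱 γ)`, and the last term is zero. -/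
theorem IsCoherentDirac.lieBivector_eq_zero (h : Q.IsCoherentDirac L)
    {X : Π b : B, Tan BM b} (hX : ∀ b, SmoothVFAt X b)
    {Y : Π e : E, Tan EM e} {β : Π e : E, Cot EM e} (hYL : ∀ e, (Y e, β e) ∈ L e)
    (hYX : ∀ e, mfderiv 𝓘(ℝ, EM) 𝓘(ℝ, BM) π e (Y e) = X (π e))
    (hβ : ∀ e, β e ∈ ann (vert EM BM π e)) {α γ : Π e : E, Cot EM e}
    (hα : ∀ e, SmoothFormAt α e) (hγ : ∀ e, SmoothFormAt γ e) (e : E) :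
    lieBivector Y Q.vertSharp α γ e = 0 := by
  -- `δ` need not satisfy `(𝒱 δ, δ) ∈ L`, but it does after a change by a form that kills `Vert`
  have hsec : ∀ δ : Π e : E, Cot EM e, (∀ e, SmoothFormAt δ e) → ∃ δ' : Π e : E, Cot EM e,
      (∀ e, (Q.vertSharp e (δ e), δ' e) ∈ L e) ∧
      (∀ e, ∀ v ∈ vert EM BM π e, δ' e v = δ e v) ∧
      (∀ e, SmoothVFAt (fun e => Q.vertSharp e (δ e)) e) ∧ ∀ e, SmoothFormAt δ' e := by
    intro δ hδ
    choose δ' h1 h2 using fun e => (h.vertSharp_mem e (δ e)).2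
    have hs : ∀ e, _ := fun e => h.smooth_section h1
      (fun e => mem_vert.1 (h.vertSharp_mem e (δ e)).1) h2 (SmoothVFAt.zero _) (hδ e)
    exact ⟨δ', h1, fun e v hv => sub_eq_zero.1 (h2 e v hv), fun e => (hs e).1, fun e => (hs e).2⟩
  obtain ⟨α', hαL, hαv, hU, hα'⟩ := hsec α hα
  obtain ⟨γ', hγL, hγv, hW, -⟩ := hsec γ hγ
  have hYβ : ∀ e, _ := fun e => h.smooth_section (α := fun _ => 0) hYL hYX
    (fun e => by rw [sub_zero]; exact hβ e) (hX (π e)) (SmoothFormAt.zero e)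
  set U : Π e : E, Tan EM e := fun e => Q.vertSharp e (α e) with hUdef
  set W : Π e : E, Tan EM e := fun e => Q.vertSharp e (γ e) with hWdef
  have hUv : ∀ e, U e ∈ vert EM BM π e := fun e => (h.vertSharp_mem e (α e)).1
  have hWv : ∀ e, W e ∈ vert EM BM π e := fun e => (h.vertSharp_mem e (γ e)).1
  have hYU := mlieBracket_mem_vert Q.smooth_proj (hX (π e)) (hYβ e).1 (hU e) hYX hUv
  have hYW := mlieBracket_mem_vert Q.smooth_proj (hX (π e)) (hYβ e).1 (hW e) hYX hWv
  -- involutivity of `L`, paired with the section `(W, γ')`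
  have hT := (h.dirac.maximal e).prop _
    (h.dirac.closed Y β U α' (fun e _ => (hYβ e).1.contMDiffWithinAt)
      (fun e _ => (hYβ e).2.contMDiffWithinAt) (fun e _ => (hU e).contMDiffWithinAt)
      (fun e _ => (hα' e).contMDiffWithinAt) hYL hαL e) _ (hγL e)
  have hT' : lieForm Y α' e (W e) - dForm β e (U e) (W e) +
      γ' e (VectorField.mlieBracket 𝓘(ℝ, EM) Y U e) = 0 := by
    have h2 : (1 / 2 : ℝ) * (lieForm Y α' e (W e) - dForm β e (U e) (W e) +
      γ' e (VectorField.mlieBracket 𝓘(ℝ, EM) Y U e)) = 0 := hT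
    linarith
  rw [dForm_apply_eq_zero_of_ann Q.smooth_proj (hYβ e).2 (hU e) (hW e) hβ hUv hWv,
    hγv e _ hYU, lieForm_apply_vectorField (hα' e) (hYβ e).1 (hW e), hαv e _ hYW,
    show (fun e => α' e (W e)) = fun e => α e (W e) from funext fun e => hαv e _ (hWv e)] at hT'
  have h1 := lieForm_apply_vectorField (hα e) (hYβ e).1 (hW e)
  have h2 := lieForm_apply_vectorField (hγ e) (hYβ e).1 (hU e)
  have h3 := h.vertSharp_skew e (lieForm Y α e) (γ e)
  unfold lieBivector
  rw [h3]
  change _ - -(lieForm Y α e (W e)) - lieForm Y γ e (U e) = 0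
  rw [h1, h2]
  linarith

end PoissonFiberBundle

end Bundle

/-! ### The Poisson-Ehresmann connection -/

section Connection

variable {EM : Type*} [NormedAddCommGroup EM] [NormedSpace ℝ EM] [FiniteDimensional ℝ EM]
  {BM : Type*} [NormedAddCommGroup BM] [NormedSpace ℝ BM]
  {FM : Type*} [NormedAddCommGroup FM] [NormedSpace ℝ FM]
  {E : Type*} [TopologicalSpace E] [ChartedSpace EM E] [IsManifold 𝓘(ℝ, EM) ∞ E]
  {B : Type*} [TopologicalSpace B] [ChartedSpace BM B] [IsManifold 𝓘(ℝ, BM) ∞ B]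
  {F : Type*} [TopologicalSpace F] [ChartedSpace FM F] [IsManifold 𝓘(ℝ, FM) ∞ F]
  {π : E → B} {P : PoissonStructure FM F}
  {Q : PoissonFiberBundle EM BM π P} {L : Π e : E, Submodule ℝ (Tan EM e × Cot EM e)}

/-- Near each point the tangent bundle has a smooth frame. -/
theorem exists_local_frame [FiniteDimensional ℝ BM] (b₀ : B) :
    ∃ X : Fin (Module.finrank ℝ BM) → Π b : B, Tan BM b,
    ∀ b ∈ (chartAt BM b₀).source, (∀ i, SmoothVFAt (X i) b) ∧
      LinearIndependent ℝ (fun i => X i b) ∧ ⊤ ≤ Submodule.span ℝ (Set.range fun i => X i b) := by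
  have : IsManifold 𝓘(ℝ, BM) 1 B := .of_le (n := ∞) (by simp)
  let t := trivializationAt BM (TangentSpace 𝓘(ℝ, BM) (M := B)) b₀
  let bas := Module.finBasis ℝ BM
  have hf := t.isLocalFrameOn_localFrame_baseSet 𝓘(ℝ, BM) ∞ bas
  refine ⟨t.localFrame bas, fun b hb => ⟨fun i => ?_, ?_, ?_⟩⟩
  · exact (hf.contMDiffOn i).contMDiffAt (t.open_baseSet.mem_nhds (by simpa [t] using hb))
  · exact hf.linearIndependent (by simpa [t] using hb)
  · exact hf.generating (by simpa [t] using hb)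

namespace PoissonFiberBundle

variable [FiniteDimensional ℝ BM]

/-- The horizontal lifts of a local frame of the base form a local frame of `H(L)`. -/
theorem IsCoherentDirac.isSmoothDistribution (h : Q.IsCoherentDirac L) :
    IsSmoothDistribution (horDist BM π L) := by
  intro e₀
  obtain ⟨X, hX⟩ := exists_local_frame (BM := BM) (π e₀)
  choose Y β hL hYX hβ using fun i => h.exists_horizontal_section (X i)
  refine ⟨π ⁻¹' (chartAt BM (π e₀)).source,
    (Q.smooth_proj e₀).continuousAt (chart_source_mem_nhds BM (π e₀)), _, Y, fun i e he => ?_,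
    fun e he => ⟨?_, le_antisymm ?_ fun u hu => ?_⟩⟩
  · exact (h.smooth_section (α := fun _ => 0) (hL i) (hYX i)
      (fun e => by rw [sub_zero]; exact hβ i e) ((hX _ he).1 i)
      (SmoothFormAt.zero e)).1.contMDiffWithinAt
  · refine LinearIndependent.of_comp (mfderiv 𝓘(ℝ, EM) 𝓘(ℝ, BM) π e).toLinearMap ?_
    have : (mfderiv 𝓘(ℝ, EM) 𝓘(ℝ, BM) π e).toLinearMap ∘ (fun i => Y i e) = fun i => X i (π e) :=
      funext fun i => hYX i e
    rw [this]
    exact (hX _ he).2.1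
  · rw [Submodule.span_le]
    rintro _ ⟨i, rfl⟩
    exact ⟨β i e, hβ i e, hL i e⟩
  · obtain ⟨c, hc⟩ := (Submodule.mem_span_range_iff_exists_fun ℝ).1
      ((hX _ he).2.2 (Submodule.mem_top (x := mfderiv 𝓘(ℝ, EM) 𝓘(ℝ, BM) π e u)))
    have hsum : ∑ i, c i • Y i e ∈ horDist BM π L e :=
      Submodule.sum_mem _ fun i _ => Submodule.smul_mem _ _ ⟨β i e, hβ i e, hL i e⟩
    have hv : u - ∑ i, c i • Y i e ∈ vert EM BM π e := by
      rw [mem_vert, map_sub, map_sum, ← hc, sub_eq_zero]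
      refine Finset.sum_congr rfl fun i _ => ?_
      rw [map_smul, hYX]
    have h0 := Submodule.disjoint_def.1 (h.isCompl e).disjoint _ (Submodule.sub_mem _ hu hsum) hv
    rw [sub_eq_zero.1 h0]
    exact Submodule.sum_mem _ fun i _ =>
      Submodule.smul_mem _ _ (Submodule.subset_span (Set.mem_range_self i))

theorem IsCoherentDirac.isPoissonEhresmann (h : Q.IsCoherentDirac L) :
    Q.IsPoissonEhresmann (horDist BM π L) where
  ehresmann := ⟨h.isSmoothDistribution, h.isCompl⟩
  poisson X hX := by
    have hX' : ∀ b, SmoothVFAt X b := fun b => hX.smoothVFAt Filter.univ_mem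
    obtain ⟨Y, β, hL, hYX, hβ⟩ := h.exists_horizontal_section X
    refine ⟨Y, fun e _ => ?_, fun e => ⟨⟨β e, hβ e, hL e⟩, hYX e⟩, fun α γ hα hγ e => ?_⟩
    · exact (h.smooth_section (α := fun _ => 0) hL hYX (fun e => by rw [sub_zero]; exact hβ e)
        (hX' _) (SmoothFormAt.zero e)).1.contMDiffWithinAt
    · exact h.lieBivector_eq_zero hX' hL hYX hβ (fun e => hα.smoothFormAt Filter.univ_mem)
        (fun e => hγ.smoothFormAt Filter.univ_mem) e

end PoissonFiberBundle

end Connection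

end PoissonGeom

end

theorem proposition2p2
    {EM : Type*} [NormedAddCommGroup EM] [NormedSpace ℝ EM] [FiniteDimensional ℝ EM]
    {BM : Type*} [NormedAddCommGroup BM] [NormedSpace ℝ BM] [FiniteDimensional ℝ BM]
    {FM : Type*} [NormedAddCommGroup FM] [NormedSpace ℝ FM] [FiniteDimensional ℝ FM]
    {E : Type*} [TopologicalSpace E] [T2Space E] [ParacompactSpace E] [ConnectedSpace E]
    [ChartedSpace EM E] [IsManifold 𝓘(ℝ, EM) ∞ E]
    {B : Type*} [TopologicalSpace B] [T2Space B] [ParacompactSpace B] [ConnectedSpace B]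
    [ChartedSpace BM B] [IsManifold 𝓘(ℝ, BM) ∞ B]
    {F : Type*} [TopologicalSpace F] [T2Space F] [ParacompactSpace F] [ConnectedSpace F]
    [ChartedSpace FM F] [IsManifold 𝓘(ℝ, FM) ∞ F]
    (π : E → B) (P : PoissonGeom.PoissonStructure FM F)
    (Q : PoissonGeom.PoissonFiberBundle EM BM π P) (hQ : Q.IsCoherent) :
    (∃ D : Π e : E, Submodule ℝ (PoissonGeom.Tan EM e), Q.IsPoissonEhresmann D) ∧
    ∀ L : Π e : E, Submodule ℝ (PoissonGeom.Tan EM e × PoissonGeom.Cot EM e),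
      Q.IsCoherentDirac L → Q.IsPoissonEhresmann (PoissonGeom.horDist BM π L) := by
  obtain ⟨L, hL⟩ := hQ
  exact ⟨⟨PoissonGeom.horDist BM π L, hL.isPoissonEhresmann⟩, fun L hL => hL.isPoissonEhresmann⟩
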